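/- **Setting.** Let $p+q=d\ge 1$, let $\mathcal X\subseteq\mathbb R^p$ be the set of contexts and $\mathcal A\subseteq\mathbb R^q$ the set of arms; on pairs $z=[x,a]\in\Phi=\mathcal X\times\mathcal A\subseteq\mathbb R^d$ use the Euclidean norm. Let $\mathcal H$ be a reproducing kernel Hilbert space of real functions on $\Phi$ with kernel $k$ and canonical feature map $\phi$, such that $k(z,z)\le 1$ for all $z$ and $\|\phi(z)-\phi(w)\|\le L_\phi\|z-w\|_2$ for all $z,w\in\Phi$, where $L_\phi\ge 0$. The reward function $f$ lies in $\mathcal H$ and $\|f\|_{\mathcal H}\le B$. Fix $\lambda\ge 1$, $b\ge 0$, $\delta\in(0,1)$, a number of rounds $T\ge 1$, an error budget $\Delta$ and a norm $\|\cdot\|$ on $\mathbb R^p$; put $\mathcal B_\Delta(c)=\{x\in\mathcal X:\|x-c\|\le\Delta\}$. In round $t$ the agent receives an imperfect context $\hat x_t\in\mathcal X$ and selects an arm $a_t\in\mathcal A$; then the true context $x_t\in\mathcal B_\Delta(\hat x_t)$ and the reward $y_t=f(x_t,a_t)+n_t$ are revealed. There is a filtration $(\mathcal F_t)$ such that, for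 $1\le t\le T$, $x_t$ and $a_t$ are $\mathcal F_{t-1}$-measurable, $n_t$ is $\mathcal F_t$-measurable and $\mathbb E[e^{\sigma n_t}\mid\mathcal F_{t-1}]\le e^{\sigma^2b^2/2}$ for all $\sigma\in\mathbb R$. The sequences $x_t,a_t$ are defined for all rounds $t\ge 1$. Write $z_t=[x_t,a_t]$ and let - $\mathbf K_t=(k(z_\tau,z_{\tau'}))_{1\le\tau,\tau'\le t-1}$, $\mathbf k_t(z)=(k(z,z_\tau))_{\tau\le t-1}$, $\mathbf y_t=(y_\tau)_{\tau\le t-1}$, $\hat f_t(z)=\mathbf k_t(z)^\top(\mathbf K_t+\lambda\mathbf I)^{-1}\mathbf y_t$, $s_t(z)^2=\frac1\lambda k(z,z)-\frac1\lambda\mathbf k_t(z)^\top(\mathbf K_t+\lambda\mathbf I)^{-1}\mathbf k_t(z)$; - $\gamma_t=\log\det(\mathbf I+\mathbf K_t/\lambda)$, $h_t=\sqrt\lambda B+b\sqrt{\gamma_t-2\log\delta}$, $U_t(z)=\hat f_t(z)+h_ts_t(z)$; - $r(x,a)=\max_{a'\in\mathcal A}f(x,a')-f(x,a)$ and $D_{a,t}(x)=\max_{a'\in\mathcal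 A}U_t(x,a')-U_t(x,a)$; - $MF_t=\max_{a\in\mathcal A}\min_{x\in\mathcal B_\Delta(\hat x_t)}f(x,a)$ and $MR_t=\min_{a\in\mathcal A}\max_{x\in\mathcal B_\Delta(\hat x_t)}r(x,a)$, where a maximum or minimum of values that need not be attained is read as a supremum or infimum. For $t\le T$ the arms are selected by MinWD: $a_t$ minimizes $a\mapsto\max_{x\in\mathcal B_\Delta(\hat x_t)}D_{a,t}(x)$ over $\mathcal A$. **Visiting conditions.** Let $\kappa\ge 0$, $\epsilon=(\kappa^2/T)^{1/(2d)}$, $N=\lceil\kappa/\epsilon^d\rceil$, and let $\Phi_\epsilon\subseteq\Phi$ be a finite $\epsilon$-covering of $\Phi$ with cells $\mathcal C_\epsilon(\bar\varphi)=\{z\in\Phi:\|z-\bar\varphi\|_2\le\epsilon\}$. The conditions are: (1) for every $\bar\varphi\in\Phi_\epsilon$ there is $1\le t\le N$ with $z_t\in\mathcal C_\epsilon(\bar\varphi)$; (2) whenever $t\ge 1$ and $z_t\in\mathcal C_\epsilon(\bar\varphi)$ with $\bar\varphi\in\Phi_\epsilon$, there is $t<t'\le t+N$ with $z_{t'}\in\mathcal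 C_\epsilon(\bar\varphi)$. **Considered sequence and dimensions.** For $t\le T$ let $\tilde a_t$ be an arm that minimizes $a\mapsto\max_{x\in\mathcal B_\Delta(\hat x_t)}r(x,a)$, let $\dot x_t$ maximize $D_{\tilde a_t,t}$ over $\mathcal B_\Delta(\hat x_t)$, and let $\dot a_t$ maximize $U_t(\dot x_t,\cdot)$ over $\mathcal A$. For $t\le T$ let $\zeta(t)$ be a round with $t\le\zeta(t)<t+N$ such that $z_{\zeta(t)}$ and $[\dot x_t,\dot a_t]$ lie in a common cell. With $M=\lfloor T/N\rfloor$, the effective dimension is $$\tilde d=\max_{1\le l\le N}\operatorname{rank}\big(k(z_{\zeta(l+iN)},z_{\zeta(l+jN)})\big)_{0\le i,j<M}.$$ Let $\bar d=\operatorname{rank}\mathbf K_T$. Terms of the form $m\log(1+T/(m\lambda))$ are read as $0$ for $m=0$. **Statement.** There is an event of probability at least $1-\delta$ on which the following holds whenever the path $(z_t)_{t\ge1}$ satisfies the visiting conditions. For all choices of $\tilde a_t,\dot x_t,\dot a_t$ as above, rounds $\zeta(t)$ as above exist, and for every choice of them the cumulative reward $F_T=\sum_{t=1}^Tf(x_t,a_t)$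 satisfies $$F_T\ \ge\ \sum_{t=1}^T\big[MF_t-MR_t\big]-2h_TT^{3/4}\sqrt{4\tilde d\log\Big(1+\frac{T}{\tilde d\lambda}\Big)+\frac1\lambda}-4\sqrt{\frac2\lambda}\,L_\phi\,\kappa^{1/d}h_T\,T^{1-\frac1{2d}}-2h_T\sqrt{2T\bar d\log\Big(1+\frac{T}{\bar d\lambda}\Big)}.$$ -/

import Mathlib

open MeasureTheory
open scoped Matrix

namespace RobustBandit

noncomputable section

/-! ### Kernel ridge regression over an RKHS

Rounds are numbered `1, 2, 3, …`.  A path of context-arm pairs is a function `z : ℕ → Z`, with the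
pair of round `t` at `z t` (the value at `0` is never used).  At the start of round `t` the
observations of rounds `1, …, t - 1` are available; they are indexed by `i : Fin (t - 1)`,
with `i` standing for round `i + 1`. -/

section Kernel

variable {Z : Type*} (H : Type*) [NormedAddCommGroup H] [InnerProductSpace ℝ H] [CompleteSpace H]
  [RKHS ℝ H Z ℝ]

/-- The canonical feature map `φ` of the RKHS `H`. -/
def feature (z : Z) : H := RKHS.kerFun H z (1 : ℝ)

/-- The scalar reproducing kernel `k` of `H`. -/
def kern (z w : Z) : ℝ := RKHS.kernel H z w (1 : ℝ)

theorem kern_eq_inner (z w : Z) : kern H z w = inner ℝ (feature H z) (feature H w) := by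
  have h := RKHS.kernel_inner (𝕜 := ℝ) (H := H) z w (1 : ℝ) (1 : ℝ)
  rw [real_inner_comm, feature, feature, ← h]
  simp [kern]

theorem apply_eq_inner (f : H) (z : Z) : f z = inner ℝ (feature H z) f := by
  rw [feature, RKHS.kerFun_inner]
  simp

/-- The kernel matrix `K_t`, of size `(t-1) × (t-1)`. -/
def gram (z : ℕ → Z) (t : ℕ) : Matrix (Fin (t - 1)) (Fin (t - 1)) ℝ :=
  Matrix.of fun i j => kern H (z (i + 1)) (z (j + 1))

/-- The vector `k_t(w)` of kernel values between `w` and the past pairs. -/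
def kvec (z : ℕ → Z) (t : ℕ) (w : Z) : Fin (t - 1) → ℝ :=
  fun i => kern H w (z (i + 1))

/-- The kernel ridge regression estimate at the pair `w` in round `t`. -/
def estimate (lam : ℝ) (z : ℕ → Z) (y : ℕ → ℝ) (t : ℕ) (w : Z) : ℝ :=
  kvec H z t w ⬝ᵥ ((gram H z t + lam • (1 : Matrix _ _ ℝ))⁻¹ *ᵥ fun i : Fin (t - 1) => y (i + 1))

/-- The confidence width `s_t(w)`. -/
def confWidth (lam : ℝ) (z : ℕ → Z) (t : ℕ) (w : Z) : ℝ :=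
  √(lam⁻¹ * kern H w w -
    lam⁻¹ * (kvec H z t w ⬝ᵥ ((gram H z t + lam • (1 : Matrix _ _ ℝ))⁻¹ *ᵥ kvec H z t w)))

/-- `γ_t = log det (I + K_t / λ)`. -/
def infoGain (lam : ℝ) (z : ℕ → Z) (t : ℕ) : ℝ :=
  Real.log (1 + lam⁻¹ • gram H z t).det

/-- `h_t = √λ B + b √(γ_t - 2 log δ)`. -/
def confRadius (lam B b δ : ℝ) (z : ℕ → Z) (t : ℕ) : ℝ :=
  √lam * B + b * √(infoGain H lam z t - 2 * Real.log δ)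

/-- The upper confidence bound `U_t(w)` on the reward of the pair `w`. -/
def ucb (lam B b δ : ℝ) (z : ℕ → Z) (y : ℕ → ℝ) (t : ℕ) (w : Z) : ℝ :=
  estimate H lam z y t w + confRadius H lam B b δ z t * confWidth H lam z t w

/-- The effective dimension: split the rounds `1, …, M N` into the `N` groups
`{l, l + N, …, l + (M - 1) N}`, `1 ≤ l ≤ N`, of `M` rounds each, and take the largest rank of a
kernel matrix of the pairs `z (ζ t)`, with `t` running over one group. (As `r ↦ r log (1 + M / r)`
is increasing, the largest rank is also the rank that maximizes `2 r log (1 + M / r)`.) -/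
def effDim (z : ℕ → Z) (ζ : ℕ → ℕ) (N M : ℕ) : ℕ :=
  (Finset.Icc 1 N).sup fun l =>
    (Matrix.of fun i j : Fin M => kern H (z (ζ (l + i * N))) (z (ζ (l + j * N)))).rank

end Kernel

/-! ### Robust objectives

Here `X` is the set of contexts, `A` the set of arms and `S` a defense region; `g` is either the
reward function or an upper confidence bound. -/

section Objectives

variable {X A : Type*}

/-- `max_{a'} g(x, a') - g(x, a)`: the regret of `a` at `x` if `g` is the reward function, the
UCB degradation of `a` at `x` if `g` is the UCB. -/
def gap (g : X × A → ℝ) (a : A) (x : X) : ℝ := (⨆ a' : A, g (x, a')) - g (x, a)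

/-- `max_{x ∈ S} (max_{a'} g(x, a') - g(x, a))`: worst-case regret or worst-case degradation. -/
def worstGap (S : Set X) (g : X × A → ℝ) (a : A) : ℝ := ⨆ x : S, gap g a x

/-- The optimal worst-case reward `MF = max_a min_{x ∈ S} f(x, a)`. -/
def optWorstReward (S : Set X) (f : X × A → ℝ) : ℝ := ⨆ a : A, ⨅ x : S, f (x, a)

/-- The optimal worst-case regret `MR = min_a max_{x ∈ S} (max_{a'} f(x, a') - f(x, a))`. -/
def optWorstRegret (S : Set X) (f : X × A → ℝ) : ℝ := ⨅ a : A, worstGap S f a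

/-- The selection rule of MinWD: `a` minimizes the worst-case degradation of the UCB. -/
def IsMinWDArm (S : Set X) (U : X × A → ℝ) (a : A) : Prop :=
  IsMinOn (worstGap S U) Set.univ a

/-- `w = (ẋ, A†(ẋ))`, where `ẋ` maximizes the UCB degradation, over the defense region, of an arm
`ã` with minimal worst-case regret, and `A†(ẋ)` is a UCB-optimal arm at `ẋ`. -/
def IsConsideredPair (S : Set X) (f U : X × A → ℝ) (w : X × A) : Prop :=
  ∃ a₀ : A, IsMinOn (worstGap S f) Set.univ a₀ ∧
    w.1 ∈ S ∧ IsMaxOn (gap U a₀) S w.1 ∧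
    IsMaxOn (fun a : A => U (w.1, a)) Set.univ w.2

end Objectives

/-! ### Contexts and arms in Euclidean space -/

section Geometry

variable {p q : ℕ} {X : Set (EuclideanSpace ℝ (Fin p))} {A : Set (EuclideanSpace ℝ (Fin q))}

/-- The concatenated vector `[x, a]`, with the Euclidean norm of `ℝ^(p+q)`. -/
def concat (z : X × A) : WithLp 2 (EuclideanSpace ℝ (Fin p) × EuclideanSpace ℝ (Fin q)) :=
  WithLp.toLp 2 ((z.1 : EuclideanSpace ℝ (Fin p)), (z.2 : EuclideanSpace ℝ (Fin q)))

/-- The defense region: contexts at distance at most `Δ` from `c` in the norm `nrm`. -/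
def defenseRegion (nrm : Seminorm ℝ (EuclideanSpace ℝ (Fin p))) (Δ : ℝ) (c : X) : Set X :=
  {x | nrm ((x : EuclideanSpace ℝ (Fin p)) - c) ≤ Δ}

/-- The cell of radius `ε` around `c`. -/
def cell (ε : ℝ) (c : X × A) : Set (X × A) := {z | ‖concat z - concat c‖ ≤ ε}

/-- `C` is an `ε`-covering of the context-arm space. -/
def IsCovering (ε : ℝ) (C : Finset (X × A)) : Prop := ∀ z : X × A, ∃ c ∈ C, z ∈ cell ε c

/-- The path `z` visits every cell during the first `N` rounds, and after each visit of a cell it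
comes back to that cell within the next `N` rounds. -/
def Recurrent (ε : ℝ) (C : Finset (X × A)) (N : ℕ) (z : ℕ → X × A) : Prop :=
  (∀ c ∈ C, ∃ t, 1 ≤ t ∧ t ≤ N ∧ z t ∈ cell ε c) ∧
  (∀ t, 1 ≤ t → ∀ c ∈ C, z t ∈ cell ε c → ∃ t', t < t' ∧ t' ≤ t + N ∧ z t' ∈ cell ε c)

/-- `ζ` matches every round `t ∈ {1, …, T}` with a round `ζ t ∈ {t, …, t + N - 1}` at which the
path `z` is in a common cell with `w t`. -/
def IsMatching (ε : ℝ) (C : Finset (X × A)) (N T : ℕ) (z w : ℕ → X × A) (ζ : ℕ → ℕ) : Prop :=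
  ∀ t, 1 ≤ t → t ≤ T →
    t ≤ ζ t ∧ ζ t < t + N ∧ ∃ c ∈ C, w t ∈ cell ε c ∧ z (ζ t) ∈ cell ε c

/-- The covering radius `ε = (κ² / T)^(1 / (2d))`; for `κ > 0` it satisfies `κ / ε^d = √T`. -/
def coverRadius (κ : ℝ) (d T : ℕ) : ℝ := (κ ^ 2 / (T : ℝ)) ^ (1 / (2 * (d : ℝ)))

/-- `N = ⌈κ / ε^d⌉`. -/
def numGroups (κ ε : ℝ) (d : ℕ) : ℕ := ⌈κ / ε ^ d⌉₊

end Geometry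

end

end RobustBandit

open RobustBandit

/-!
The proof combines a self-normalized concentration inequality in the RKHS with a comparison of
confidence widths along the path.

**Confidence.** Let `V_n = λ + ∑_{i < n} φ_i φ_iᵀ` and `S_n = ∑_{i < n} e_i φ_i`, with `φ_i` and
`e_i` the feature and the noise of round `i + 1`. The ridge estimate at a pair is the inner
product of its feature with `V⁻¹ ∑ y_i φ_i`, and the width is the `V⁻¹`-norm of the feature
(`estimate_eq`, `confWidth_eq`), so the estimation error is at most `√λ ‖f‖ + ‖S‖_{V⁻¹}` times the
width (`abs_ridge_sub_le`). The process `det(1 + K_n / λ)^{-1/2} exp(‖S_n‖²_{V_n⁻¹} / (2 b²))` is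
a supermartingale: by the rank-one update of `V⁻¹` it grows by a factor that depends on one scalar
noise variable, and this factor is a mixture of `e^{σ n - σ² b² / 2}` over a one-dimensional
Gaussian `σ` (`lintegral_mul_mixRatio_le`). Hence no Gaussian measure on the Hilbert space is
needed, and Ville's inequality gives the event (`exists_event_noise_le`).

**Regret of a round.** On the event, the selected arm has a worst-case degradation of at most that
of the arm with minimal worst-case regret, which is at most `MR_t` plus twice the scaled width at
the considered pair (`reward_ge_of_isMinWDArm`).

**Sums of widths.** The widths at the selected pairs are summed by the elliptic potential lemma
with the rank of the kernel matrix as dimension (`sum_inner_ridgeInv_le`, `log_det_one_add_le`).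
The width at a considered pair is moved to a later visit `ζ t` of its cell at a Lipschitz cost.
Rounds that are congruent modulo `N` have distinct matched pairs, each of which is observed before
the next round of the group; `V ↦ V⁻¹` being antitone, the elliptic potential lemma applies in
every group (`sum_group_confWidth_sq_le`). The last round and the rounds outside the complete
groups are at most `√T` in number (`sum_confWidth_matched_le`).

**The last round.** The matrix `K_T` contains the pairs of the first `T - 1` rounds only, so the
width at the pair of round `T` is not controlled by it. The regret of that round is bounded by
`2 B ≤ 2 h_T / √λ` instead, which takes the place of the width at its considered pair in the sum
over the left-over rounds (`sum_reward_ge`).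
-/

namespace RobustBandit

/-! ### The regularized covariance operator and its inverse -/

section Ridge

variable {H : Type*} [NormedAddCommGroup H] [InnerProductSpace ℝ H]

/-- The regularized covariance operator `V_n = λ + ∑_{i < n} φ_i φ_iᵀ`. -/
def regCov (lam : ℝ) (φ : ℕ → H) (n : ℕ) (v : H) : H :=
  lam • v + ∑ i ∈ Finset.range n, inner ℝ (φ i) v • φ i

/-- The inverse of `V_n = λ + ∑_{i < n} φ_i φ_iᵀ`, built one rank-one (Sherman–Morrison) update at a
time. -/
noncomputable def ridgeInv (lam : ℝ) (φ : ℕ → H) : ℕ → H →ₗ[ℝ] H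
  | 0 => lam⁻¹ • LinearMap.id
  | n + 1 => ridgeInv lam φ n - (1 + inner ℝ (φ n) (ridgeInv lam φ n (φ n)))⁻¹ •
      (innerₛₗ ℝ (ridgeInv lam φ n (φ n))).smulRight (ridgeInv lam φ n (φ n))

theorem ridgeInv_zero_apply (lam : ℝ) (φ : ℕ → H) (v : H) : ridgeInv lam φ 0 v = lam⁻¹ • v := rfl

theorem ridgeInv_succ_apply (lam : ℝ) (φ : ℕ → H) (n : ℕ) (v : H) :
    ridgeInv lam φ (n + 1) v = ridgeInv lam φ n v -
      (1 + inner ℝ (φ n) (ridgeInv lam φ n (φ n)))⁻¹ •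
        inner ℝ (ridgeInv lam φ n (φ n)) v • ridgeInv lam φ n (φ n) := rfl

theorem ridgeInv_inner_left (lam : ℝ) (φ : ℕ → H) (n : ℕ) (u v : H) :
    inner ℝ (ridgeInv lam φ n u) v = inner ℝ u (ridgeInv lam φ n v) := by
  induction n generalizing u v with
  | zero => simp [ridgeInv_zero_apply, inner_smul_left, inner_smul_right]
  | succ n ih =>
    simp only [ridgeInv_succ_apply, inner_sub_left, inner_sub_right, inner_smul_left,
      inner_smul_right, ih, RCLike.conj_to_real]
    rw [← ih (φ n) u, real_inner_comm u]
    ring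

theorem regCov_inner_left (lam : ℝ) (φ : ℕ → H) (n : ℕ) (u v : H) :
    inner ℝ (regCov lam φ n u) v = inner ℝ u (regCov lam φ n v) := by
  simp only [regCov, inner_add_left, inner_add_right, inner_smul_left, inner_smul_right, sum_inner,
    inner_sum, RCLike.conj_to_real]
  refine congrArg₂ _ rfl (Finset.sum_congr rfl fun i _ => ?_)
  rw [real_inner_comm u, mul_comm]

theorem inner_regCov_self (lam : ℝ) (φ : ℕ → H) (n : ℕ) (u : H) :
    inner ℝ u (regCov lam φ n u) =
      lam * ‖u‖ ^ 2 + ∑ i ∈ Finset.range n, inner ℝ (φ i) u ^ 2 := by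
  simp only [regCov, inner_add_right, inner_smul_right, inner_sum, real_inner_self_eq_norm_sq]
  refine congrArg₂ _ rfl (Finset.sum_congr rfl fun i _ => ?_)
  rw [real_inner_comm u, sq]

theorem regCov_sub (lam : ℝ) (φ : ℕ → H) (n : ℕ) (u v : H) :
    regCov lam φ n (u - v) = regCov lam φ n u - regCov lam φ n v := by
  simp only [regCov, smul_sub, inner_sub_right, sub_smul, Finset.sum_sub_distrib]
  abel

theorem regCov_smul (lam : ℝ) (φ : ℕ → H) (n : ℕ) (c : ℝ) (u : H) :
    regCov lam φ n (c • u) = c • regCov lam φ n u := by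
  simp only [regCov, smul_add, inner_smul_right, Finset.smul_sum, smul_smul, mul_comm]

variable {lam : ℝ} (hlam : 0 < lam) (φ : ℕ → H) (n : ℕ)

include hlam

theorem inner_regCov_self_nonneg (u : H) : 0 ≤ inner ℝ u (regCov lam φ n u) := by
  rw [inner_regCov_self]
  positivity

theorem regCov_ridgeInv (v : H) : regCov lam φ n (ridgeInv lam φ n v) = v := by
  induction n generalizing v with
  | zero => simp [regCov, ridgeInv_zero_apply, smul_smul, hlam.ne']
  | succ n ih =>
    have hs : 0 ≤ inner ℝ (φ n) (ridgeInv lam φ n (φ n)) := by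
      have := inner_regCov_self_nonneg hlam φ n (ridgeInv lam φ n (φ n))
      rwa [ih, real_inner_comm] at this
    have hV : ∀ u, regCov lam φ (n + 1) u = regCov lam φ n u + inner ℝ (φ n) u • φ n := fun u => by
      simp only [regCov, Finset.sum_range_succ, add_assoc]
    rw [hV, ridgeInv_succ_apply, regCov_sub, regCov_smul, regCov_smul, ih, ih, inner_sub_right,
      inner_smul_right, inner_smul_right, ridgeInv_inner_left]
    set s := inner ℝ (φ n) (ridgeInv lam φ n (φ n))
    have h1 : (1 + s) ≠ 0 := by positivity
    rw [sub_add, smul_smul, ← sub_smul]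
    have : (1 + s)⁻¹ * inner ℝ (φ n) (ridgeInv lam φ n v) - (inner ℝ (φ n) (ridgeInv lam φ n v) -
        (1 + s)⁻¹ * (inner ℝ (φ n) (ridgeInv lam φ n v) * s)) = 0 := by
      field_simp
      ring
    rw [this, zero_smul, sub_zero]

theorem ridgeInv_regCov (v : H) : ridgeInv lam φ n (regCov lam φ n v) = v := by
  refine ext_inner_left ℝ fun u => ?_
  rw [← ridgeInv_inner_left, ← regCov_inner_left, regCov_ridgeInv hlam]

theorem inner_ridgeInv_self_nonneg (v : H) : 0 ≤ inner ℝ v (ridgeInv lam φ n v) := by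
  have := inner_regCov_self_nonneg hlam φ n (ridgeInv lam φ n v)
  rwa [regCov_ridgeInv hlam, real_inner_comm] at this

/-- The variational bound `2⟨u, v⟩ - ⟨u, V u⟩ ≤ ⟨v, V⁻¹ v⟩`, with equality at `u = V⁻¹ v`. -/
theorem two_inner_sub_le_inner_ridgeInv (u v : H) :
    2 * inner ℝ u v - inner ℝ u (regCov lam φ n u) ≤ inner ℝ v (ridgeInv lam φ n v) := by
  have h := inner_regCov_self_nonneg hlam φ n (u - ridgeInv lam φ n v)
  rw [regCov_sub, regCov_ridgeInv hlam, inner_sub_left, inner_sub_right, inner_sub_right,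
    ridgeInv_inner_left, ridgeInv_inner_left, ridgeInv_regCov hlam, real_inner_comm u v] at h
  rw [real_inner_comm v u] at *
  linarith

/-- `V ↦ ⟨v, V⁻¹ v⟩` is antitone in the quadratic form of `V`. -/
theorem inner_ridgeInv_self_anti (ψ : ℕ → H) (m : ℕ) (v : H)
    (h : ∀ u, ∑ i ∈ Finset.range m, inner ℝ (ψ i) u ^ 2
      ≤ ∑ i ∈ Finset.range n, inner ℝ (φ i) u ^ 2) :
    inner ℝ v (ridgeInv lam φ n v) ≤ inner ℝ v (ridgeInv lam ψ m v) := by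
  have h1 := two_inner_sub_le_inner_ridgeInv hlam ψ m (ridgeInv lam φ n v) v
  have h2 : inner ℝ (ridgeInv lam φ n v) (regCov lam φ n (ridgeInv lam φ n v))
      = inner ℝ v (ridgeInv lam φ n v) := by
    rw [regCov_ridgeInv hlam, ridgeInv_inner_left]
  rw [ridgeInv_inner_left] at h1
  rw [inner_regCov_self] at h1 h2
  linarith [h (ridgeInv lam φ n v)]

theorem inner_ridgeInv_self_le (v : H) :
    inner ℝ v (ridgeInv lam φ n v) ≤ lam⁻¹ * ‖v‖ ^ 2 := by
  have h := inner_ridgeInv_self_anti hlam φ n φ 0 v fun u => by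
    simpa using Finset.sum_nonneg fun i _ => sq_nonneg _
  rwa [ridgeInv_zero_apply, inner_smul_right, real_inner_self_eq_norm_sq] at h

/-- Cauchy–Schwarz inequality for the form `⟨u, V⁻¹ v⟩`. -/
theorem abs_inner_ridgeInv_le (u v : H) :
    |inner ℝ u (ridgeInv lam φ n v)| ≤
      √(inner ℝ u (ridgeInv lam φ n u)) * √(inner ℝ v (ridgeInv lam φ n v)) := by
  have hsymm : inner ℝ v (ridgeInv lam φ n u) = inner ℝ u (ridgeInv lam φ n v) := by
    rw [← ridgeInv_inner_left, real_inner_comm]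
  have h : ∀ t : ℝ, 0 ≤ inner ℝ v (ridgeInv lam φ n v) * (t * t) +
      2 * inner ℝ u (ridgeInv lam φ n v) * t + inner ℝ u (ridgeInv lam φ n u) := fun t => by
    have := inner_ridgeInv_self_nonneg hlam φ n (u + t • v)
    simp only [map_add, map_smul, inner_add_left, inner_add_right, inner_smul_left,
      inner_smul_right, RCLike.conj_to_real, hsymm] at this
    linarith
  have hd := discrim_le_zero h
  rw [← Real.sqrt_mul (inner_ridgeInv_self_nonneg hlam φ n u)]
  refine Real.abs_le_sqrt ?_
  rw [discrim] at hd
  linarith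

theorem sqrt_inner_ridgeInv_add_le (u v : H) :
    √(inner ℝ (u + v) (ridgeInv lam φ n (u + v))) ≤
      √(inner ℝ u (ridgeInv lam φ n u)) + √(inner ℝ v (ridgeInv lam φ n v)) := by
  have hsymm : inner ℝ v (ridgeInv lam φ n u) = inner ℝ u (ridgeInv lam φ n v) := by
    rw [← ridgeInv_inner_left, real_inner_comm]
  refine Real.sqrt_le_iff.2 ⟨by positivity, ?_⟩
  have h := (le_abs_self _).trans (abs_inner_ridgeInv_le hlam φ n u v)
  simp only [map_add, inner_add_left, inner_add_right, hsymm]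
  rw [add_sq, Real.sq_sqrt (inner_ridgeInv_self_nonneg hlam φ n u),
    Real.sq_sqrt (inner_ridgeInv_self_nonneg hlam φ n v)]
  linarith

theorem sqrt_inner_ridgeInv_le (v : H) :
    √(inner ℝ v (ridgeInv lam φ n v)) ≤ ‖v‖ / √lam := by
  refine Real.sqrt_le_iff.2 ⟨by positivity, (inner_ridgeInv_self_le hlam φ n v).trans_eq ?_⟩
  rw [div_pow, Real.sq_sqrt hlam.le, inv_mul_eq_div]

/-- The change of `‖S‖²_{V⁻¹}` when `S` and `V` are updated by one observation. -/
theorem inner_ridgeInv_succ (S : H) (e : ℝ) :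
    inner ℝ (S + e • φ n) (ridgeInv lam φ (n + 1) (S + e • φ n)) =
      inner ℝ S (ridgeInv lam φ n S) +
        (2 * e * inner ℝ (φ n) (ridgeInv lam φ n S)
          + e ^ 2 * inner ℝ (φ n) (ridgeInv lam φ n (φ n))
          - inner ℝ (φ n) (ridgeInv lam φ n S) ^ 2)
          / (1 + inner ℝ (φ n) (ridgeInv lam φ n (φ n))) := by
  have hsymm : inner ℝ S (ridgeInv lam φ n (φ n)) = inner ℝ (φ n) (ridgeInv lam φ n S) := by
    rw [← ridgeInv_inner_left, real_inner_comm]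
  have hs := inner_ridgeInv_self_nonneg hlam φ n (φ n)
  simp only [ridgeInv_succ_apply, map_add, map_smul, inner_add_left, inner_add_right,
    inner_sub_right, inner_smul_left, inner_smul_right, RCLike.conj_to_real, ridgeInv_inner_left,
    hsymm]
  set s := inner ℝ (φ n) (ridgeInv lam φ n (φ n))
  have h1 : (1 + s) ≠ 0 := by positivity
  field_simp
  ring

/-- Pathwise confidence bound for ridge regression on the data `⟨φ_i, f⟩ + e_i`: the error splits
into the shrinkage of `f` and the noise `S = ∑ e_i φ_i` measured in the `V⁻¹`-norm. -/
theorem abs_ridge_sub_le (f : H) (e : ℕ → ℝ) (v : H) :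
    |inner ℝ v (ridgeInv lam φ n (∑ i ∈ Finset.range n, (inner ℝ (φ i) f + e i) • φ i))
        - inner ℝ v f| ≤
      (√lam * ‖f‖ + √(inner ℝ (∑ i ∈ Finset.range n, e i • φ i)
        (ridgeInv lam φ n (∑ i ∈ Finset.range n, e i • φ i)))) *
        √(inner ℝ v (ridgeInv lam φ n v)) := by
  set S := ∑ i ∈ Finset.range n, e i • φ i with hS
  have h1 : ∑ i ∈ Finset.range n, (inner ℝ (φ i) f + e i) • φ i
      = regCov lam φ n f - lam • f + S := by
    simp only [regCov, add_smul, Finset.sum_add_distrib, hS, add_sub_cancel_left]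
  have h2 : inner ℝ v (ridgeInv lam φ n (regCov lam φ n f - lam • f + S)) - inner ℝ v f
      = inner ℝ v (ridgeInv lam φ n S) - lam * inner ℝ v (ridgeInv lam φ n f) := by
    simp only [map_add, map_sub, map_smul, ridgeInv_regCov hlam, inner_add_right, inner_sub_right,
      inner_smul_right]
    ring
  rw [h1, h2]
  have h3 := abs_inner_ridgeInv_le hlam φ n v S
  have h4 := abs_inner_ridgeInv_le hlam φ n v f
  have h5 := sqrt_inner_ridgeInv_le hlam φ n f
  have h6 : lam * (‖f‖ / √lam) = √lam * ‖f‖ := by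
    have : lam = √lam * √lam := (Real.mul_self_sqrt hlam.le).symm
    have h0 : √lam ≠ 0 := (Real.sqrt_pos.2 hlam).ne'
    field_simp
    rw [sq, ← this, mul_comm]
  calc _ ≤ |inner ℝ v (ridgeInv lam φ n S)| + |lam * inner ℝ v (ridgeInv lam φ n f)| :=
        abs_sub _ _
    _ = |inner ℝ v (ridgeInv lam φ n S)| + lam * |inner ℝ v (ridgeInv lam φ n f)| := by
        rw [abs_mul, abs_of_pos hlam]
    _ ≤ √(inner ℝ v (ridgeInv lam φ n v)) * √(inner ℝ S (ridgeInv lam φ n S))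
        + lam * (√(inner ℝ v (ridgeInv lam φ n v)) * (‖f‖ / √lam)) := by
        gcongr
        exact h4.trans (by gcongr)
    _ = _ := by rw [mul_left_comm, h6]; ring

end Ridge

/-! ### Kernel matrices -/

section GramMatrix

variable {H : Type*} [NormedAddCommGroup H] [InnerProductSpace ℝ H]

theorem gram_mulVec_apply {n : ℕ} (φ : ℕ → H) (α : Fin n → ℝ) (i : Fin n) :
    (Matrix.gram ℝ (fun i : Fin n => φ i) *ᵥ α) i = inner ℝ (φ i) (∑ j : Fin n, α j • φ j) := by
  simp only [Matrix.mulVec, dotProduct, Matrix.gram_apply, inner_sum, inner_smul_right]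
  exact Finset.sum_congr rfl fun j _ => mul_comm _ _

theorem posDef_gram_add_smul_one {lam : ℝ} (hlam : 0 < lam) {n : ℕ} (φ : ℕ → H) :
    (Matrix.gram ℝ (fun i : Fin n => φ i) + lam • (1 : Matrix _ _ ℝ)).PosDef :=
  Matrix.PosDef.posSemidef_add (Matrix.posSemidef_gram ℝ _) (Matrix.PosDef.one.smul hlam)

/-- The dual (kernel matrix) form of ridge regression agrees with the primal (operator) form. -/
theorem dotProduct_inv_mulVec_eq_inner_ridgeInv {lam : ℝ} (hlam : 0 < lam) {n : ℕ} (φ : ℕ → H)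
    (v : H) (y : ℕ → ℝ) :
    (fun i : Fin n => inner ℝ v (φ i)) ⬝ᵥ
      ((Matrix.gram ℝ (fun i : Fin n => φ i) + lam • (1 : Matrix _ _ ℝ))⁻¹ *ᵥ
        fun i : Fin n => y i) =
      inner ℝ v (ridgeInv lam φ n (∑ i ∈ Finset.range n, y i • φ i)) := by
  set K := Matrix.gram ℝ (fun i : Fin n => φ i)
  set α := (K + lam • (1 : Matrix _ _ ℝ))⁻¹ *ᵥ fun i : Fin n => y i with hα
  have hα' : (K + lam • (1 : Matrix _ _ ℝ)) *ᵥ α = fun i : Fin n => y i := by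
    rw [hα, Matrix.mulVec_mulVec, Matrix.mul_nonsing_inv _
      ((posDef_gram_add_smul_one hlam φ).isUnit.map Matrix.detMonoidHom), Matrix.one_mulVec]
  have key : regCov lam φ n (∑ j : Fin n, α j • φ j) = ∑ i ∈ Finset.range n, y i • φ i := by
    rw [regCov, Finset.sum_range, Finset.sum_range, Finset.smul_sum, ← Finset.sum_add_distrib]
    refine Finset.sum_congr rfl fun i _ => ?_
    rw [← gram_mulVec_apply, smul_smul, ← add_smul, ← congrFun hα' i]
    simp [Matrix.add_mulVec, Matrix.smul_mulVec, add_comm, K]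
  rw [← key, ridgeInv_regCov hlam, inner_sum]
  simp only [dotProduct, inner_smul_right, mul_comm]

theorem inner_ridgeInv_self_eq {lam : ℝ} (hlam : 0 < lam) (φ : ℕ → H) (n : ℕ) (v : H) :
    inner ℝ v (ridgeInv lam φ n v) = lam⁻¹ * inner ℝ v v -
      lam⁻¹ * inner ℝ v (ridgeInv lam φ n (∑ i ∈ Finset.range n, inner ℝ v (φ i) • φ i)) := by
  have h : ∑ i ∈ Finset.range n, inner ℝ v (φ i) • φ i = regCov lam φ n v - lam • v := by
    simp only [regCov, add_sub_cancel_left, real_inner_comm v]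
  rw [h, map_sub, ridgeInv_regCov hlam, map_smul, inner_sub_right, inner_smul_right]
  field_simp
  ring

/-- The determinant `det (1 + K_n / λ)` gains the factor `1 + ⟨φ_n, V_n⁻¹ φ_n⟩` with the `n`-th
observation (Schur complement). -/
theorem det_one_add_gram_succ {lam : ℝ} (hlam : 0 < lam) (φ : ℕ → H) (n : ℕ) :
    (1 + lam⁻¹ • Matrix.gram ℝ (fun i : Fin (n + 1) => φ i)).det =
      (1 + lam⁻¹ • Matrix.gram ℝ (fun i : Fin n => φ i)).det *
        (1 + inner ℝ (φ n) (ridgeInv lam φ n (φ n))) := by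
  set K := Matrix.gram ℝ (fun i : Fin n => φ i) with hK
  set A : Matrix (Fin n) (Fin n) ℝ := 1 + lam⁻¹ • K with hA
  have hscale : A = lam⁻¹ • (K + lam • 1) := by
    rw [hA, smul_add, smul_smul, inv_mul_cancel₀ hlam.ne', one_smul, add_comm]
  have hunit : IsUnit (K + lam • (1 : Matrix _ _ ℝ)).det :=
    (posDef_gram_add_smul_one hlam φ).isUnit.map Matrix.detMonoidHom
  have hAunit : IsUnit A.det := by
    rw [hscale, Matrix.det_smul]
    exact (IsUnit.mk0 _ (by positivity)).mul hunit
  let _ := A.invertibleOfIsUnitDet hAunit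
  set k : Fin n → ℝ := fun i => inner ℝ (φ n) (φ i) with hk
  have hblock : (1 + lam⁻¹ • Matrix.gram ℝ (fun i : Fin (n + 1) => φ i)).submatrix
      finSumFinEquiv finSumFinEquiv = Matrix.fromBlocks A
        (Matrix.of fun i (_ : Fin 1) => lam⁻¹ * k i) (Matrix.of fun (_ : Fin 1) i => lam⁻¹ * k i)
        (Matrix.of fun _ _ : Fin 1 => 1 + lam⁻¹ * inner ℝ (φ n) (φ n)) := by
    ext i j
    rcases i with i | i <;> rcases j with j | j
    · simp [hA, hK, Matrix.one_apply, Matrix.gram_apply, Fin.ext_iff]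
    · have : (i : ℕ) ≠ n := i.2.ne
      simp [Matrix.gram_apply, Fin.ext_iff, this, hk, real_inner_comm]
    · have : n ≠ (j : ℕ) := j.2.ne'
      simp [Matrix.gram_apply, Fin.ext_iff, this, hk]
    · simp [Matrix.one_apply, Matrix.gram_apply, Fin.ext_iff]
  have hsolve : A⁻¹ *ᵥ (fun i => lam⁻¹ * k i) = (K + lam • (1 : Matrix _ _ ℝ))⁻¹ *ᵥ k := by
    have : (fun i => lam⁻¹ * k i) = A *ᵥ ((K + lam • (1 : Matrix _ _ ℝ))⁻¹ *ᵥ k) := by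
      rw [hscale, Matrix.smul_mulVec, Matrix.mulVec_mulVec, Matrix.mul_nonsing_inv _ hunit,
        Matrix.one_mulVec]
      rfl
    rw [this, Matrix.mulVec_mulVec, Matrix.nonsing_inv_mul _ hAunit, Matrix.one_mulVec]
  have hschur : (Matrix.of fun (_ : Fin 1) i => lam⁻¹ * k i) * ⅟A *
      (Matrix.of fun i (_ : Fin 1) => lam⁻¹ * k i) = Matrix.of fun _ _ : Fin 1 =>
        lam⁻¹ * (k ⬝ᵥ ((K + lam • (1 : Matrix _ _ ℝ))⁻¹ *ᵥ k)) := by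
    ext i j
    rw [Matrix.mul_assoc, Matrix.invOf_eq_nonsing_inv, ← hsolve, Matrix.of_apply, ← smul_eq_mul,
      ← smul_dotProduct]
    rfl
  rw [← Matrix.det_submatrix_equiv_self finSumFinEquiv, hblock, Matrix.det_fromBlocks₁₁, hschur,
    Matrix.det_fin_one, inner_ridgeInv_self_eq hlam,
    ← dotProduct_inv_mulVec_eq_inner_ridgeInv hlam φ (φ n) fun i => inner ℝ (φ n) (φ i)]
  simp only [Matrix.sub_apply, Matrix.of_apply, hK, hk]
  ring

theorem det_one_add_gram_eq_prod {lam : ℝ} (hlam : 0 < lam) (φ : ℕ → H) (n : ℕ) :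
    (1 + lam⁻¹ • Matrix.gram ℝ (fun i : Fin n => φ i)).det =
      ∏ i ∈ Finset.range n, (1 + inner ℝ (φ i) (ridgeInv lam φ i (φ i))) := by
  induction n with
  | zero => simp
  | succ n ih => rw [det_one_add_gram_succ hlam, Finset.prod_range_succ, ih]

theorem log_det_one_add_gram_eq_sum {lam : ℝ} (hlam : 0 < lam) (φ : ℕ → H) (n : ℕ) :
    Real.log (1 + lam⁻¹ • Matrix.gram ℝ (fun i : Fin n => φ i)).det =
      ∑ i ∈ Finset.range n, Real.log (1 + inner ℝ (φ i) (ridgeInv lam φ i (φ i))) := by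
  rw [det_one_add_gram_eq_prod hlam, Real.log_prod]
  intro i _
  have := inner_ridgeInv_self_nonneg hlam φ i (φ i)
  positivity

/-- `log det (1 + K) ≤ r log (1 + tr K / r)` for a positive semidefinite matrix of rank `r`. -/
theorem log_det_one_add_le {ι : Type*} [Fintype ι] [DecidableEq ι] {K : Matrix ι ι ℝ}
    (hK : K.PosSemidef) {c τ : ℝ} (hc : 0 ≤ c) (hτ : K.trace ≤ τ) :
    Real.log (1 + c • K).det ≤ K.rank * Real.log (1 + c * τ / K.rank) := by
  set e := hK.isHermitian.eigenvalues with he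
  have he0 : ∀ i, 0 ≤ e i := fun i => hK.eigenvalues_nonneg i
  have hdet : (1 + c • K).det = ∏ i, (1 + c * e i) := by
    set U : Matrix ι ι ℝ := (hK.isHermitian.eigenvectorUnitary : Matrix ι ι ℝ) with hU
    have hUU : U * star U = 1 := Unitary.coe_mul_star_self _
    have hspec : K = U * Matrix.diagonal e * star U := by
      have := hK.isHermitian.spectral_theorem
      simpa [Unitary.conjStarAlgAut_apply, Function.comp_def] using this
    have h1 : 1 + c • K = U * (Matrix.diagonal fun i => 1 + c * e i) * star U := by
      have : (Matrix.diagonal fun i => 1 + c * e i) = 1 + c • Matrix.diagonal e := by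
        ext i j
        rcases eq_or_ne i j with rfl | hij
        · simp
        · simp [hij]
      rw [this, Matrix.mul_add, Matrix.add_mul, Matrix.mul_one, hUU, Matrix.mul_smul,
        Matrix.smul_mul, ← hspec]
    rw [h1, Matrix.det_mul, Matrix.det_mul, mul_right_comm, ← Matrix.det_mul, hUU, Matrix.det_one,
      one_mul, Matrix.det_diagonal]
  have htr : ∑ i, e i ≤ τ := by
    have := hK.isHermitian.trace_eq_sum_eigenvalues
    simp only [RCLike.ofReal_real_eq_id, id_eq] at this
    rwa [← this]
  set s : Finset ι := Finset.univ.filter fun i => e i ≠ 0 with hs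
  have hrank : K.rank = s.card := by
    rw [hK.isHermitian.rank_eq_card_non_zero_eigs, Fintype.card_subtype]
  have hlog : Real.log (1 + c • K).det = ∑ i ∈ s, Real.log (1 + c * e i) := by
    rw [hdet, Real.log_prod fun i _ => by have := he0 i; positivity]
    refine (Finset.sum_subset (Finset.subset_univ s) fun i _ hi => ?_).symm
    have : e i = 0 := by simpa [hs] using hi
    simp [this]
  have hsum : ∑ i ∈ s, e i ≤ τ :=
    (Finset.sum_le_sum_of_subset_of_nonneg (Finset.subset_univ s) fun i _ _ => he0 i).trans htr
  rw [hlog, hrank]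
  rcases s.eq_empty_or_nonempty with h0 | h0
  · simp [h0]
  have hr : (0 : ℝ) < s.card := by exact_mod_cast h0.card_pos
  have hτ0 : 0 ≤ τ := (Finset.sum_nonneg fun i _ => he0 i).trans hsum
  set w : ℝ := 1 + c * τ / s.card with hw
  have hw0 : 0 < w := by positivity
  -- the tangent of `log` at the mean `w` of the upper bounds replaces Jensen's inequality
  have hi : ∀ i ∈ s, Real.log (1 + c * e i) ≤ Real.log w + ((1 + c * e i) / w - 1) := fun i _ => by
    have h1 : 0 < 1 + c * e i := by have := he0 i; positivity
    have := Real.log_le_sub_one_of_pos (div_pos h1 hw0)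
    rw [Real.log_div h1.ne' hw0.ne'] at this
    linarith
  refine (Finset.sum_le_sum hi).trans ?_
  rw [Finset.sum_add_distrib, Finset.sum_sub_distrib, ← Finset.sum_div, Finset.sum_add_distrib,
    ← Finset.mul_sum]
  simp only [Finset.sum_const, nsmul_eq_mul, mul_one]
  have : (s.card + c * ∑ i ∈ s, e i) / w ≤ s.card := by
    rw [div_le_iff₀ hw0, hw, mul_add, mul_one, mul_div_cancel₀ _ hr.ne']
    gcongr
  linarith

theorem le_two_mul_log_one_add {u : ℝ} (h0 : 0 ≤ u) (h1 : u ≤ 1) : u ≤ 2 * Real.log (1 + u) := by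
  have h := Real.one_sub_inv_le_log_of_pos (show 0 < 1 + u by positivity)
  have : u / 2 ≤ 1 - (1 + u)⁻¹ := by
    rw [show 1 - (1 + u)⁻¹ = u / (1 + u) by field_simp; ring]
    gcongr
    linarith
  linarith

/-- Elliptic potential lemma, with the rank of the kernel matrix in place of the dimension. -/
theorem sum_inner_ridgeInv_le {lam : ℝ} (hlam : 1 ≤ lam) (φ : ℕ → H) (n : ℕ)
    (hφ : ∀ i < n, ‖φ i‖ ≤ 1) :
    ∑ i ∈ Finset.range n, inner ℝ (φ i) (ridgeInv lam φ i (φ i)) ≤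
      2 * ((Matrix.gram ℝ (fun i : Fin n => φ i)).rank *
        Real.log (1 + n / ((Matrix.gram ℝ (fun i : Fin n => φ i)).rank * lam))) := by
  have hl : 0 < lam := by linarith
  have h1 : ∀ i ∈ Finset.range n, inner ℝ (φ i) (ridgeInv lam φ i (φ i)) ≤
      2 * Real.log (1 + inner ℝ (φ i) (ridgeInv lam φ i (φ i))) := fun i hi => by
    refine le_two_mul_log_one_add (inner_ridgeInv_self_nonneg hl φ i _) ?_
    refine (inner_ridgeInv_self_le hl φ i _).trans ?_
    exact mul_le_one₀ (inv_le_one_of_one_le₀ hlam) (by positivity)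
      (pow_le_one₀ (norm_nonneg _) (hφ i (Finset.mem_range.1 hi)))
  refine (Finset.sum_le_sum h1).trans ?_
  rw [← Finset.mul_sum, ← log_det_one_add_gram_eq_sum hl]
  have htr : (Matrix.gram ℝ (fun i : Fin n => φ i)).trace ≤ n := by
    refine (Finset.sum_le_card_nsmul _ _ 1 fun i _ => ?_).trans (by simp)
    rw [Matrix.diag_apply, Matrix.gram_apply, real_inner_self_eq_norm_sq]
    exact pow_le_one₀ (norm_nonneg _) (hφ i i.2)
  have := log_det_one_add_le (Matrix.posSemidef_gram ℝ fun i : Fin n => φ i)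
    (inv_nonneg.2 hl.le) htr
  rw [inv_mul_eq_div, div_div, mul_comm lam] at this
  gcongr

theorem mul_log_one_add_div_mono {c a b : ℝ} (hc : 0 ≤ c) (ha : 0 ≤ a) (hab : a ≤ b) :
    a * Real.log (1 + c / a) ≤ b * Real.log (1 + c / b) := by
  rcases ha.eq_or_lt with rfl | ha
  · rw [zero_mul]
    exact mul_nonneg hab (Real.log_nonneg (by simp; positivity))
  have hb : 0 < b := ha.trans_le hab
  -- concavity of `log` between `1` and `1 + c / a`
  have h := strictConcaveOn_log_Ioi.concaveOn.2
    (show (1 : ℝ) ∈ Set.Ioi 0 from Set.mem_Ioi.2 one_pos)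
    (show 1 + c / a ∈ Set.Ioi 0 from Set.mem_Ioi.2 (by positivity))
    (sub_nonneg.2 ((div_le_one hb).2 hab)) (show 0 ≤ a / b by positivity) (by ring)
  simp only [smul_eq_mul, Real.log_one, mul_zero, zero_add] at h
  have h2 : (1 - a / b) * 1 + a / b * (1 + c / a) = 1 + c / b := by field_simp; ring
  rw [h2, div_mul_eq_mul_div, div_le_iff₀ hb] at h
  linarith

end GramMatrix

/-! ### The self-normalized concentration inequality -/

section Concentration

open ProbabilityTheory
open scoped ENNReal NNReal

variable {Ω : Type*} {m mΩ : MeasurableSpace Ω} {μ : Measure Ω}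

/-- A conditional exponential moment bound integrates against any nonnegative function known
beforehand. -/
theorem lintegral_mul_exp_le [IsFiniteMeasure μ] (hm : m ≤ mΩ) {n : Ω → ℝ}
    {σ r : ℝ} (hint : Integrable (fun ω => Real.exp (σ * n ω)) μ)
    (hle : μ[fun ω => Real.exp (σ * n ω) | m] ≤ᵐ[μ] fun _ => Real.exp r)
    {W : Ω → ℝ≥0∞} (hW : Measurable[m] W) :
    ∫⁻ ω, W ω * ENNReal.ofReal (Real.exp (σ * n ω - r)) ∂μ ≤ ∫⁻ ω, W ω ∂μ := by
  set g : Ω → ℝ≥0∞ := fun ω => ENNReal.ofReal (Real.exp (σ * n ω - r)) with hg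
  have hexp : ∀ ω, Real.exp (σ * n ω - r) = Real.exp (-r) * Real.exp (σ * n ω) := fun ω => by
    rw [← Real.exp_add]; ring_nf
  have hgi : Integrable (fun ω => Real.exp (σ * n ω - r)) μ := by
    simp only [hexp]
    exact hint.const_mul _
  have hgm : AEMeasurable g μ := hgi.aemeasurable.ennreal_ofReal
  have hmeas : (μ.withDensity g).trim hm ≤ μ.trim hm := by
    refine Measure.le_iff.2 fun s hs => ?_
    rw [trim_measurableSet_eq hm hs, trim_measurableSet_eq hm hs, withDensity_apply _ (hm s hs),
      ← ofReal_integral_eq_lintegral_ofReal hgi.integrableOn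
        (Filter.Eventually.of_forall fun ω => (Real.exp_pos _).le)]
    refine ENNReal.ofReal_le_of_le_toReal ?_
    simp only [hexp]
    rw [integral_const_mul, ← setIntegral_condExp hm hint hs]
    calc _ ≤ Real.exp (-r) * ∫ _ in s, Real.exp r ∂μ := by
          refine mul_le_mul_of_nonneg_left ?_ (Real.exp_pos _).le
          exact setIntegral_mono_ae integrable_condExp.integrableOn (by simp) hle
      _ = _ := by
          rw [setIntegral_const, smul_eq_mul, mul_left_comm, ← Real.exp_add]
          simp [Measure.real]
  calc ∫⁻ ω, W ω * g ω ∂μ = ∫⁻ ω, W ω ∂(μ.withDensity g) := by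
        rw [lintegral_withDensity_eq_lintegral_mul₀ hgm (hW.mono hm le_rfl).aemeasurable]
        simp only [Pi.mul_apply, mul_comm]
    _ = ∫⁻ ω, W ω ∂((μ.withDensity g).trim hm) := (lintegral_trim hm hW).symm
    _ ≤ ∫⁻ ω, W ω ∂(μ.trim hm) := lintegral_mono' hmeas le_rfl
    _ = ∫⁻ ω, W ω ∂μ := lintegral_trim hm hW

/-- Completing the square: tilting a Gaussian density by `e^{σ n - c σ² / 2}` gives a multiple of a
Gaussian density. -/
theorem gaussianPDFReal_mul_exp (a c n σ : ℝ) (v : ℝ≥0) (hv : v ≠ 0) (hc : 0 ≤ c) :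
    gaussianPDFReal a v σ * Real.exp (σ * n - σ ^ 2 * c / 2) =
      (√(1 + c * v))⁻¹ * Real.exp ((2 * a * n + v * n ^ 2 - c * a ^ 2) / (2 * (1 + c * v))) *
        gaussianPDFReal ((a + v * n) / (1 + c * v)) (v / (1 + c * v).toNNReal) σ := by
  have hv' : (0 : ℝ) < v := by exact_mod_cast pos_iff_ne_zero.2 hv
  have h1 : 0 < 1 + c * v := by positivity
  have hcoe : ((v / (1 + c * v).toNNReal : ℝ≥0) : ℝ) = v / (1 + c * v) := by
    rw [NNReal.coe_div, Real.coe_toNNReal _ h1.le]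
  have hnorm : 2 * Real.pi * v = (1 + c * v) * (2 * Real.pi * (v / (1 + c * v))) := by
    field_simp
  have hexp : -(σ - a) ^ 2 / (2 * v) + (σ * n - σ ^ 2 * c / 2) =
      (2 * a * n + v * n ^ 2 - c * a ^ 2) / (2 * (1 + c * v)) +
        -(σ - (a + v * n) / (1 + c * v)) ^ 2 / (2 * (v / (1 + c * v))) := by
    field_simp
    ring
  rw [gaussianPDFReal, gaussianPDFReal, hcoe, mul_assoc, ← Real.exp_add, mul_mul_mul_comm,
    ← Real.exp_add, ← mul_inv, ← Real.sqrt_mul h1.le, ← hnorm, ← hexp]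

theorem lintegral_gaussianPDF_mul_exp (a c n : ℝ) (v : ℝ≥0) (hv : v ≠ 0) (hc : 0 ≤ c) :
    ∫⁻ σ, gaussianPDF a v σ * ENNReal.ofReal (Real.exp (σ * n - σ ^ 2 * c / 2)) =
      ENNReal.ofReal ((√(1 + c * v))⁻¹ *
        Real.exp ((2 * a * n + v * n ^ 2 - c * a ^ 2) / (2 * (1 + c * v)))) := by
  have h1 : 0 < 1 + c * v := by positivity
  have hv' : v / (1 + c * v).toNNReal ≠ 0 := by
    refine div_ne_zero hv ?_
    rwa [Ne, Real.toNNReal_eq_zero, not_le]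
  have : ∀ σ, gaussianPDF a v σ * ENNReal.ofReal (Real.exp (σ * n - σ ^ 2 * c / 2)) =
      ENNReal.ofReal ((√(1 + c * v))⁻¹ *
        Real.exp ((2 * a * n + v * n ^ 2 - c * a ^ 2) / (2 * (1 + c * v)))) *
      gaussianPDF ((a + v * n) / (1 + c * v)) (v / (1 + c * v).toNNReal) σ := fun σ => by
    rw [gaussianPDF, gaussianPDF, ← ENNReal.ofReal_mul (gaussianPDFReal_nonneg _ _ _),
      ← ENNReal.ofReal_mul (by positivity), gaussianPDFReal_mul_exp a c n σ v hv hc]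
  simp only [this]
  rw [lintegral_const_mul _ (measurable_gaussianPDF _ _), lintegral_gaussianPDF_eq_one _ hv',
    mul_one]

/-- The factor by which `det(V)^{-1/2} exp(‖S‖²_{V⁻¹} / (2 b²))` grows when an observation with
noise `n`, predicted noise `a` and predictive variance `s` arrives. -/
noncomputable def mixRatio (b a s n : ℝ) : ℝ :=
  (√(1 + s))⁻¹ * Real.exp ((2 * n * a + n ^ 2 * s - a ^ 2) / (1 + s) / (2 * b ^ 2))

theorem mixRatio_zero (b n : ℝ) : mixRatio b 0 0 n = 1 := by simp [mixRatio]

/-- The growth factor is a Gaussian mixture of the factors `e^{σ n - σ² b² / 2}`. -/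
theorem lintegral_gaussianPDF_eq_mixRatio {b s : ℝ} (hb : 0 < b) (hs : 0 < s) (a n : ℝ) :
    ∫⁻ σ, gaussianPDF (a / b ^ 2) (s / b ^ 2).toNNReal σ *
      ENNReal.ofReal (Real.exp (σ * n - σ ^ 2 * b ^ 2 / 2)) =
        ENNReal.ofReal (mixRatio b a s n) := by
  have hv : (s / b ^ 2).toNNReal ≠ 0 := by
    rw [Ne, Real.toNNReal_eq_zero, not_le]
    positivity
  have hexp : (2 * (a / b ^ 2) * n + s / b ^ 2 * n ^ 2 - b ^ 2 * (a / b ^ 2) ^ 2) / (2 * (1 + s)) =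
      (2 * n * a + n ^ 2 * s - a ^ 2) / (1 + s) / (2 * b ^ 2) := by
    field_simp
  rw [lintegral_gaussianPDF_mul_exp _ _ _ _ hv (sq_nonneg b),
    Real.coe_toNNReal _ (by positivity), mul_div_cancel₀ _ (by positivity : b ^ 2 ≠ 0), hexp,
    mixRatio]

/-- The Gaussian mixing density is jointly measurable in the parameters and the variable. -/
theorem measurable_gaussianPDF_comp {a : Ω → ℝ} {v : Ω → ℝ≥0} (ha : Measurable a)
    (hv : Measurable v) : Measurable fun p : Ω × ℝ => gaussianPDF (a p.1) (v p.1) p.2 := by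
  simp only [gaussianPDF, gaussianPDFReal]
  fun_prop

/-- Mixing the factors `e^{σ n - r σ}` over a random density `ρ` of `σ` that is known before the
noise `n` keeps their conditional expectation at most one. -/
theorem lintegral_mul_mixture_le [IsFiniteMeasure μ] (hm : m ≤ mΩ) {n : Ω → ℝ}
    (hn : Measurable n) {r : ℝ → ℝ} (hr : Measurable r)
    (hsub : ∀ σ : ℝ, Integrable (fun ω => Real.exp (σ * n ω)) μ ∧
      μ[fun ω => Real.exp (σ * n ω) | m] ≤ᵐ[μ] fun _ => Real.exp (r σ))
    {ρ : Ω → ℝ → ℝ≥0∞}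
    (hρ : @Measurable (Ω × ℝ) _ (m.prod inferInstance) _ fun p => ρ p.1 p.2)
    (hρ1 : ∀ ω, ∫⁻ σ, ρ ω σ = 1) {W : Ω → ℝ≥0∞} (hW : Measurable[m] W) :
    ∫⁻ ω, W ω * (∫⁻ σ, ρ ω σ * ENNReal.ofReal (Real.exp (σ * n ω - r σ))) ∂μ ≤ ∫⁻ ω, W ω ∂μ := by
  have hle : m.prod (inferInstance : MeasurableSpace ℝ) ≤ mΩ.prod inferInstance :=
    sup_le_sup (MeasurableSpace.comap_mono hm) le_rfl
  have hρ' : Measurable fun p : Ω × ℝ => ρ p.1 p.2 := hρ.mono hle le_rfl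
  have hWρ : Measurable fun p : Ω × ℝ => W p.1 * ρ p.1 p.2 :=
    ((hW.mono hm le_rfl).comp measurable_fst).mul hρ'
  have hE : Measurable fun p : Ω × ℝ => ENNReal.ofReal (Real.exp (p.2 * n p.1 - r p.2)) := by
    fun_prop
  have h1 : ∀ ω, W ω * ∫⁻ σ, ρ ω σ * ENNReal.ofReal (Real.exp (σ * n ω - r σ)) =
      ∫⁻ σ, W ω * ρ ω σ * ENNReal.ofReal (Real.exp (σ * n ω - r σ)) := fun ω => by
    have : Measurable fun σ => ρ ω σ * ENNReal.ofReal (Real.exp (σ * n ω - r σ)) :=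
      (hρ'.mul hE).comp measurable_prodMk_left
    simp only [mul_assoc]
    rw [lintegral_const_mul _ this]
  have h2 : ∀ ω, W ω = ∫⁻ σ, W ω * ρ ω σ := fun ω => by
    have : Measurable fun σ => ρ ω σ := hρ'.comp measurable_prodMk_left
    rw [lintegral_const_mul _ this, hρ1, mul_one]
  calc _ = ∫⁻ ω, (∫⁻ σ, W ω * ρ ω σ * ENNReal.ofReal (Real.exp (σ * n ω - r σ))) ∂μ :=
        lintegral_congr h1
    _ = ∫⁻ σ, (∫⁻ ω, W ω * ρ ω σ * ENNReal.ofReal (Real.exp (σ * n ω - r σ)) ∂μ) :=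
        lintegral_lintegral_swap (hWρ.mul hE).aemeasurable
    _ ≤ ∫⁻ σ, (∫⁻ ω, W ω * ρ ω σ ∂μ) := by
        refine lintegral_mono fun σ => ?_
        have hσ : Measurable[m] fun ω => ρ ω σ := hρ.comp (@measurable_prodMk_right _ _ m _ σ)
        exact lintegral_mul_exp_le hm (hsub σ).1 (hsub σ).2 (hW.mul hσ)
    _ = ∫⁻ ω, (∫⁻ σ, W ω * ρ ω σ) ∂μ := (lintegral_lintegral_swap hWρ.aemeasurable).symm
    _ = ∫⁻ ω, W ω ∂μ := lintegral_congr fun ω => (h2 ω).symm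

/-- The expected growth factor is at most one: it is the mixture of the exponential
supermartingale factors `e^{σ n - σ² b² / 2}` over a Gaussian `σ` with mean `a / b²` and variance
`s / b²`, both known before the noise. -/
theorem lintegral_mul_mixRatio_le [IsFiniteMeasure μ] (hm : m ≤ mΩ) {n : Ω → ℝ}
    (hn : Measurable n) {b : ℝ} (hb : 0 < b)
    (hsub : ∀ σ : ℝ, Integrable (fun ω => Real.exp (σ * n ω)) μ ∧
      μ[fun ω => Real.exp (σ * n ω) | m] ≤ᵐ[μ] fun _ => Real.exp (σ ^ 2 * b ^ 2 / 2))
    {a s : Ω → ℝ} (ha : Measurable[m] a) (hs : Measurable[m] s) (hs0 : ∀ ω, 0 ≤ s ω)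
    (has : ∀ ω, s ω = 0 → a ω = 0) {W : Ω → ℝ≥0∞} (hW : Measurable[m] W) :
    ∫⁻ ω, W ω * ENNReal.ofReal (mixRatio b (a ω) (s ω) (n ω)) ∂μ ≤ ∫⁻ ω, W ω ∂μ := by
  classical
  have hD : MeasurableSet[m] {ω | s ω = 0} := hs (measurableSet_singleton 0)
  have hD' : MeasurableSet {ω | s ω = 0} := hm _ hD
  -- where `s` vanishes the ratio is one; the variance is set to one there to have a density
  set v : Ω → ℝ≥0 := fun ω => if s ω = 0 then 1 else (s ω / b ^ 2).toNNReal with hv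
  have hvm : Measurable[m] v :=
    Measurable.ite hD measurable_const (hs.div_const _).real_toNNReal
  have hv0 : ∀ ω, v ω ≠ 0 := fun ω => by
    by_cases h : s ω = 0
    · simp [hv, h]
    · have : 0 < s ω := lt_of_le_of_ne (hs0 ω) (Ne.symm h)
      simp only [hv, h, if_false, Ne, Real.toNNReal_eq_zero, not_le]
      positivity
  have hρm : @Measurable (Ω × ℝ) _ (m.prod inferInstance) _
      fun p => gaussianPDF (a p.1 / b ^ 2) (v p.1) p.2 :=
    @measurable_gaussianPDF_comp Ω m (fun ω => a ω / b ^ 2) v (ha.div_const _) hvm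
  have hmix := fun {W' : Ω → ℝ≥0∞} (hW' : Measurable[m] W') =>
    lintegral_mul_mixture_le hm hn (r := fun σ => σ ^ 2 * b ^ 2 / 2) (by fun_prop) hsub
      (ρ := fun ω σ => gaussianPDF (a ω / b ^ 2) (v ω) σ) hρm
      (fun ω => lintegral_gaussianPDF_eq_one _ (hv0 ω)) hW'
  have hon : ∫⁻ ω in {ω | s ω = 0}, W ω * ENNReal.ofReal (mixRatio b (a ω) (s ω) (n ω)) ∂μ =
      ∫⁻ ω in {ω | s ω = 0}, W ω ∂μ := by
    refine setLIntegral_congr_fun hD' fun ω hω => ?_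
    have h0 : s ω = 0 := hω
    simp only [h0, has ω h0, mixRatio_zero, ENNReal.ofReal_one, mul_one]
  have hoff : ∫⁻ ω in {ω | s ω = 0}ᶜ, W ω * ENNReal.ofReal (mixRatio b (a ω) (s ω) (n ω)) ∂μ ≤
      ∫⁻ ω in {ω | s ω = 0}ᶜ, W ω ∂μ := by
    have h1 := hmix (hW.indicator hD.compl)
    rw [← lintegral_indicator hD'.compl, ← lintegral_indicator hD'.compl]
    convert h1 using 3 with ω
    by_cases h : s ω = 0
    · simp [h]
    · have h' : ω ∈ {ω | s ω = 0}ᶜ := h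
      rw [Set.indicator_of_mem h', Set.indicator_of_mem h']
      simp only [hv, h, if_false]
      rw [lintegral_gaussianPDF_eq_mixRatio hb (lt_of_le_of_ne (hs0 ω) (Ne.symm h))]
  rw [← lintegral_add_compl _ hD', ← lintegral_add_compl W hD', hon]
  exact add_le_add le_rfl hoff

/-- Ville's inequality on a finite horizon, for a process that starts at one and grows by factors
`R_t` of conditional expectation at most one. -/
theorem measure_exists_prod_ge_le [IsProbabilityMeasure μ] (ℱ : Filtration ℕ mΩ) (n : ℕ)
    (R : ℕ → Ω → ℝ≥0∞) (hR : ∀ t < n, Measurable[ℱ (t + 1)] (R t))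
    (hmart : ∀ t < n, ∀ W : Ω → ℝ≥0∞, Measurable[ℱ t] W →
      ∫⁻ ω, W ω * R t ω ∂μ ≤ ∫⁻ ω, W ω ∂μ)
    (c : ℝ≥0∞) (hc : c ≠ 0) (hc' : c ≠ ∞) :
    μ {ω | ∃ t ≤ n, c ≤ ∏ i ∈ Finset.range t, R i ω} ≤ c⁻¹ := by
  -- the process stopped when it first reaches `c`
  let Y : ℕ → Ω → ℝ≥0∞ := fun t ω =>
    Nat.rec (motive := fun _ => ℝ≥0∞) 1 (fun i y => y * (if c ≤ y then 1 else R i ω)) t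
  have hY0 : ∀ ω, Y 0 ω = 1 := fun _ => rfl
  have hY1 : ∀ t ω, Y (t + 1) ω = Y t ω * (if c ≤ Y t ω then 1 else R t ω) := fun _ _ => rfl
  have hYm : ∀ t ≤ n, Measurable[ℱ t] (Y t) := by
    intro t
    induction t with
    | zero => exact fun _ => measurable_const
    | succ t ih =>
      intro ht
      have h1 : Measurable[ℱ (t + 1)] (Y t) := (ih (by omega)).mono (ℱ.mono t.le_succ) le_rfl
      exact h1.mul (Measurable.ite (measurableSet_le measurable_const h1) measurable_const
        (hR t (by omega)))
  have hYint : ∀ t ≤ n, ∫⁻ ω, Y t ω ∂μ ≤ 1 := by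
    intro t
    induction t with
    | zero => simp [hY0]
    | succ t ih =>
      intro ht
      refine le_trans ?_ (ih (by omega))
      have hS : MeasurableSet[ℱ t] {ω | c ≤ Y t ω} :=
        measurableSet_le measurable_const (hYm t (by omega))
      have hS' := ℱ.le t _ hS
      rw [← lintegral_add_compl _ hS', ← lintegral_add_compl (Y t) hS']
      refine add_le_add (setLIntegral_congr_fun hS' fun ω hω => ?_).le ?_
      · rw [hY1, if_pos (show c ≤ Y t ω from hω), mul_one]
      · rw [← lintegral_indicator hS'.compl, ← lintegral_indicator hS'.compl]
        refine le_trans (le_of_eq (lintegral_congr fun ω => ?_)) (hmart t (by omega) _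
          ((hYm t (by omega)).indicator hS.compl))
        by_cases hω : ω ∈ {ω | c ≤ Y t ω}ᶜ
        · rw [Set.indicator_of_mem hω, Set.indicator_of_mem hω, hY1,
            if_neg (show ¬ c ≤ Y t ω from hω)]
        · simp [Set.indicator_of_notMem hω]
  have hbefore : ∀ ω t, Y t ω < c → ∀ i ≤ t, Y i ω = ∏ j ∈ Finset.range i, R j ω ∧ Y i ω < c := by
    intro ω t
    induction t with
    | zero => exact fun h i hi => by obtain rfl : i = 0 := by omega
                                     exact ⟨by simp [hY0], h⟩
    | succ t ih =>
      intro h i hi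
      have hlt : Y t ω < c := by
        by_contra hge
        rw [hY1, if_pos (not_lt.1 hge), mul_one] at h
        exact hge h
      rcases Nat.le_succ_iff.1 hi with hi | rfl
      · exact ih hlt i hi
      · refine ⟨?_, h⟩
        rw [hY1, if_neg (not_le.2 hlt), Finset.prod_range_succ, (ih hlt t le_rfl).1]
  have hsubset : {ω | ∃ t ≤ n, c ≤ ∏ i ∈ Finset.range t, R i ω} ⊆ {ω | c ≤ Y n ω} := by
    rintro ω ⟨t, ht, hct⟩
    by_contra hlt
    obtain ⟨h1, h2⟩ := hbefore ω n (not_le.1 hlt) t ht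
    exact absurd (h1 ▸ hct) (not_le.2 h2)
  refine (measure_mono hsubset).trans ?_
  refine (meas_ge_le_lintegral_div ((hYm n le_rfl).mono (ℱ.le n) le_rfl).aemeasurable
    hc hc').trans ?_
  rw [← one_div]
  gcongr
  exact hYint n le_rfl

/-- A variable that is conditionally subgaussian with variance proxy zero vanishes. -/
theorem ae_eq_zero_of_condExp_exp_le_one [IsProbabilityMeasure μ] (hm : m ≤ mΩ) {n : Ω → ℝ}
    (hsub : ∀ σ : ℝ, Integrable (fun ω => Real.exp (σ * n ω)) μ ∧
      μ[fun ω => Real.exp (σ * n ω) | m] ≤ᵐ[μ] fun _ => 1) : ∀ᵐ ω ∂μ, n ω = 0 := by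
  have hle : ∀ σ : ℝ, ∫ ω, Real.exp (σ * n ω) ∂μ ≤ 1 := fun σ => by
    rw [← integral_condExp hm]
    refine (integral_mono_ae integrable_condExp (integrable_const 1) (hsub σ).2).trans (by simp)
  -- `e^x + e^{-x} - 2` is nonnegative, with integral at most zero
  have hexp : ∀ x : ℝ, Real.exp (1 * x) + Real.exp (-1 * x) - 2 =
      (Real.exp (x / 2) - Real.exp (-(x / 2))) ^ 2 := fun x => by
    rw [sub_sq, ← Real.exp_nat_mul, ← Real.exp_nat_mul, mul_assoc, ← Real.exp_add]
    simp only [Nat.cast_ofNat, add_neg_cancel, Real.exp_zero]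
    ring_nf
  have hint : Integrable (fun ω => Real.exp (1 * n ω) + Real.exp (-1 * n ω) - 2) μ :=
    ((hsub 1).1.add (hsub (-1)).1).sub (integrable_const _)
  have h0 : ∫ ω, (Real.exp (1 * n ω) + Real.exp (-1 * n ω) - 2) ∂μ = 0 := by
    refine le_antisymm ?_ (integral_nonneg fun ω => by simp only [hexp]; positivity)
    have hadd := integral_add (hsub 1).1 (hsub (-1)).1
    have hsubtr := integral_sub ((hsub 1).1.add (hsub (-1)).1) (integrable_const (2 : ℝ))
    simp only [Pi.add_apply, integral_const, probReal_univ, one_smul] at hadd hsubtr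
    rw [hsubtr, hadd]
    linarith [hle 1, hle (-1)]
  rw [integral_eq_zero_iff_of_nonneg (fun ω => by simp only [hexp, Pi.zero_apply]; positivity)
    hint] at h0
  filter_upwards [h0] with ω hω
  simp only [hexp, Pi.zero_apply, sq_eq_zero_iff, sub_eq_zero] at hω
  linarith [Real.exp_injective hω]

end Concentration

section SelfNormalized

open scoped ENNReal NNReal

variable {H : Type*} [NormedAddCommGroup H] [InnerProductSpace ℝ H]

/-- The product of the growth factors is `det(1 + K_n / λ)^{-1/2} exp(‖S_n‖²_{V_n⁻¹} / (2 b²))`. -/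
theorem prod_mixRatio_eq {lam : ℝ} (hlam : 0 < lam) (φ : ℕ → H) (e : ℕ → ℝ) (b : ℝ) (n : ℕ) :
    ∏ i ∈ Finset.range n, mixRatio b
        (inner ℝ (φ i) (ridgeInv lam φ i (∑ j ∈ Finset.range i, e j • φ j)))
        (inner ℝ (φ i) (ridgeInv lam φ i (φ i))) (e i) =
      (√(1 + lam⁻¹ • Matrix.gram ℝ (fun i : Fin n => φ i)).det)⁻¹ *
        Real.exp (inner ℝ (∑ j ∈ Finset.range n, e j • φ j)
          (ridgeInv lam φ n (∑ j ∈ Finset.range n, e j • φ j)) / (2 * b ^ 2)) := by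
  induction n with
  | zero => simp
  | succ n ih =>
    have hs := inner_ridgeInv_self_nonneg hlam φ n (φ n)
    rw [Finset.prod_range_succ, ih, Finset.sum_range_succ, inner_ridgeInv_succ hlam,
      det_one_add_gram_succ hlam, Real.sqrt_mul' _ (by positivity), mul_inv, mixRatio,
      mul_mul_mul_comm, ← Real.exp_add, ← add_div]

variable {Ω : Type*} {mΩ : MeasurableSpace Ω} {μ : Measure Ω}

theorem measurable_inner_ridgeInv {m : MeasurableSpace Ω} (lam : ℝ) (φ : ℕ → Ω → H) (k : ℕ)
    (hφ : ∀ i ≤ k, ∀ j ≤ k, Measurable fun ω => inner ℝ (φ i ω) (φ j ω)) :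
    ∀ l ≤ k, ∀ i ≤ k, ∀ j ≤ k,
      Measurable fun ω => inner ℝ (φ i ω) (ridgeInv lam (fun s => φ s ω) l (φ j ω)) := by
  intro l
  induction l with
  | zero =>
    intro _ i hi j hj
    simp only [ridgeInv_zero_apply, inner_smul_right]
    exact (hφ i hi j hj).const_mul _
  | succ l ih =>
    intro hl i hi j hj
    have ih := ih (by omega)
    simp only [ridgeInv_succ_apply, inner_sub_right, inner_smul_right, ridgeInv_inner_left]
    exact (ih i hi j hj).sub (((ih l (by omega) l (by omega)).const_add 1).inv.mul
      ((ih l (by omega) j hj).mul (ih i hi l (by omega))))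

/-- Self-normalized concentration in a Hilbert space, uniformly in time: with probability at least
`1 - δ`, `‖S_k‖²_{V_k⁻¹} ≤ b² (log det (1 + K_k / λ) - 2 log δ)` for all `k ≤ n`. -/
theorem exists_event_noise_le [IsProbabilityMeasure μ] (ℱ : Filtration ℕ mΩ) {lam b δ : ℝ}
    (hlam : 0 < lam) (hb : 0 ≤ b) (hδ0 : 0 < δ) (hδ1 : δ < 1) (n : ℕ)
    (φ : ℕ → Ω → H) (e : ℕ → Ω → ℝ)
    (hφ : ∀ k < n, ∀ i ≤ k, ∀ j ≤ k, Measurable[ℱ k] fun ω => inner ℝ (φ i ω) (φ j ω))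
    (he : ∀ i < n, Measurable[ℱ (i + 1)] (e i))
    (hsub : ∀ i < n, ∀ σ : ℝ, Integrable (fun ω => Real.exp (σ * e i ω)) μ ∧
      μ[fun ω => Real.exp (σ * e i ω) | ℱ i] ≤ᵐ[μ] fun _ => Real.exp (σ ^ 2 * b ^ 2 / 2)) :
    ∃ E : Set Ω, MeasurableSet E ∧ ENNReal.ofReal (1 - δ) ≤ μ E ∧ ∀ ω ∈ E, ∀ k ≤ n,
      inner ℝ (∑ j ∈ Finset.range k, e j ω • φ j ω)
          (ridgeInv lam (fun s => φ s ω) k (∑ j ∈ Finset.range k, e j ω • φ j ω)) ≤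
        b ^ 2 * (Real.log (1 + lam⁻¹ • Matrix.gram ℝ (fun i : Fin k => φ i ω)).det
          - 2 * Real.log δ) := by
  have hem : ∀ i < n, Measurable (e i) := fun i hi => (he i hi).mono (ℱ.le _) le_rfl
  rcases hb.eq_or_lt with rfl | hb
  · have hzero : ∀ᵐ ω ∂μ, ∀ i < n, e i ω = 0 := by
      rw [ae_all_iff]
      intro i
      by_cases hi : i < n
      · have := ae_eq_zero_of_condExp_exp_le_one (ℱ.le i) (n := e i) (μ := μ)
          (by simpa using hsub i hi)
        filter_upwards [this] with ω hω _ using hω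
      · exact Filter.Eventually.of_forall fun ω h => absurd h hi
    have hmeas : MeasurableSet {ω | ∀ i < n, e i ω = 0} := by
      simp only [Set.ofPred_forall]
      exact MeasurableSet.iInter fun i => MeasurableSet.iInter fun hi =>
        hem i hi (measurableSet_singleton 0)
    refine ⟨_, hmeas, ?_, fun ω hω k hk => ?_⟩
    · rw [(mem_ae_iff_prob_eq_one hmeas).1 hzero]
      exact ENNReal.ofReal_le_one.2 (by linarith)
    · have : ∑ j ∈ Finset.range k, e j ω • φ j ω = 0 :=
        Finset.sum_eq_zero fun j hj => by
          rw [hω j ((Finset.mem_range.1 hj).trans_le hk), zero_smul]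
      simp [this]
  -- predicted noise and predictive variance
  set a : ℕ → Ω → ℝ := fun i ω => inner ℝ (φ i ω)
    (ridgeInv lam (fun s => φ s ω) i (∑ j ∈ Finset.range i, e j ω • φ j ω)) with ha
  set s : ℕ → Ω → ℝ := fun i ω => inner ℝ (φ i ω) (ridgeInv lam (fun s => φ s ω) i (φ i ω)) with hs
  have hs0 : ∀ i ω, 0 ≤ s i ω := fun i ω => inner_ridgeInv_self_nonneg hlam _ _ _
  have hsm : ∀ i < n, Measurable[ℱ i] (s i) := fun i hi =>
    measurable_inner_ridgeInv lam φ i (hφ i hi) i le_rfl i le_rfl i le_rfl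
  have ham : ∀ i < n, Measurable[ℱ i] (a i) := fun i hi => by
    simp only [ha, map_sum, map_smul, inner_sum, inner_smul_right]
    refine Finset.measurable_sum _ fun j hj => ?_
    have hj : j < i := Finset.mem_range.1 hj
    exact ((he j (by omega)).mono (ℱ.mono hj) le_rfl).mul
      (measurable_inner_ridgeInv lam φ i (hφ i hi) i le_rfl i le_rfl j hj.le)
  have has : ∀ i ω, s i ω = 0 → a i ω = 0 := fun i ω h => by
    have := abs_inner_ridgeInv_le hlam (fun s => φ s ω) i (φ i ω)
      (∑ j ∈ Finset.range i, e j ω • φ j ω)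
    rw [show inner ℝ (φ i ω) (ridgeInv lam (fun s => φ s ω) i (φ i ω)) = 0 from h, Real.sqrt_zero,
      zero_mul] at this
    exact abs_eq_zero.1 (le_antisymm this (abs_nonneg _))
  set R : ℕ → Ω → ℝ≥0∞ := fun i ω => ENNReal.ofReal (mixRatio b (a i ω) (s i ω) (e i ω)) with hR
  have hRm : ∀ i < n, Measurable[ℱ (i + 1)] (R i) := fun i hi => by
    have h1 := (ham i hi).mono (ℱ.mono i.le_succ) le_rfl
    have h2 := (hsm i hi).mono (ℱ.mono i.le_succ) le_rfl
    have h3 := he i hi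
    simp only [hR, mixRatio]
    fun_prop
  have hville := measure_exists_prod_ge_le (μ := μ) ℱ n R hRm
    (fun i hi W hW => lintegral_mul_mixRatio_le (ℱ.le i) (hem i hi) hb (hsub i hi) (ham i hi)
      (hsm i hi) (hs0 i) (has i) hW) (ENNReal.ofReal δ⁻¹) (by simpa using hδ0) ENNReal.ofReal_ne_top
  set Bad : Set Ω := {ω | ∃ t ≤ n, ENNReal.ofReal δ⁻¹ ≤ ∏ i ∈ Finset.range t, R i ω} with hBad
  have hBadm : MeasurableSet Bad := by
    simp only [hBad, Set.ofPred_exists, Set.ofPred_and]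
    refine MeasurableSet.iUnion fun t => ?_
    by_cases ht : t ≤ n
    · simp only [ht, Set.ofPred_true, Set.univ_inter]
      refine measurableSet_le measurable_const (Finset.measurable_prod _ fun i hi => ?_)
      exact (hRm i ((Finset.mem_range.1 hi).trans_le ht)).mono (ℱ.le _) le_rfl
    · simp [ht]
  refine ⟨Badᶜ, hBadm.compl, ?_, fun ω hω k hk => ?_⟩
  · rw [prob_compl_eq_one_sub hBadm, ENNReal.ofReal_sub _ hδ0.le, ENNReal.ofReal_one]
    refine tsub_le_tsub_left (hville.trans_eq ?_) _
    rw [ENNReal.ofReal_inv_of_pos hδ0, inv_inv]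
  · have hlt : ∏ i ∈ Finset.range k, R i ω < ENNReal.ofReal δ⁻¹ := by
      by_contra h
      exact hω ⟨k, hk, not_lt.1 h⟩
    have hdet : 1 ≤ (1 + lam⁻¹ • Matrix.gram ℝ (fun i : Fin k => φ i ω)).det := by
      rw [det_one_add_gram_eq_prod hlam fun i => φ i ω]
      have := Finset.prod_le_prod (s := Finset.range k) (f := fun _ => (1 : ℝ))
        (fun _ _ => zero_le_one) fun i _ => le_add_of_nonneg_right (a := 1) (hs0 i ω)
      simpa using this
    rw [← ENNReal.ofReal_prod_of_nonneg fun i _ => by unfold mixRatio; positivity,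
      ENNReal.ofReal_lt_ofReal_iff (by positivity)] at hlt
    rw [prod_mixRatio_eq hlam (fun i => φ i ω) fun i => e i ω] at hlt
    have hsq : 0 < √(1 + lam⁻¹ • Matrix.gram ℝ (fun i : Fin k => φ i ω)).det :=
      Real.sqrt_pos.2 (by linarith)
    have hlog := Real.log_lt_log (by positivity) hlt
    rw [Real.log_mul (by positivity) (by positivity), Real.log_exp, Real.log_inv, Real.log_inv,
      Real.log_sqrt (by linarith), neg_add_lt_iff_lt_add, div_lt_iff₀ (by positivity)] at hlog
    linarith

end SelfNormalized

/-! ### Kernel ridge regression in primal form -/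

section Primal

variable {Z : Type*} (H : Type*) [NormedAddCommGroup H] [InnerProductSpace ℝ H] [CompleteSpace H]
  [RKHS ℝ H Z ℝ]

/-- The features of the rounds of a path, with `i` standing for round `i + 1`. -/
noncomputable def pathFeature (z : ℕ → Z) (i : ℕ) : H := feature H (z (i + 1))

theorem gram_eq (z : ℕ → Z) (t : ℕ) :
    gram H z t = Matrix.gram ℝ fun i : Fin (t - 1) => pathFeature H z i := by
  ext i j
  simp [gram, kern_eq_inner, Matrix.gram_apply, pathFeature]

theorem kvec_eq (z : ℕ → Z) (t : ℕ) (w : Z) :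
    kvec H z t w = fun i : Fin (t - 1) => inner ℝ (feature H w) (pathFeature H z i) := by
  ext i
  simp [kvec, kern_eq_inner, pathFeature]

variable {lam : ℝ} (hlam : 0 < lam)

include hlam

theorem estimate_eq (z : ℕ → Z) (y : ℕ → ℝ) (t : ℕ) (w : Z) :
    estimate H lam z y t w = inner ℝ (feature H w) (ridgeInv lam (pathFeature H z) (t - 1)
      (∑ i ∈ Finset.range (t - 1), y (i + 1) • pathFeature H z i)) := by
  rw [estimate, kvec_eq, gram_eq,
    ← dotProduct_inv_mulVec_eq_inner_ridgeInv hlam (pathFeature H z) _ fun i => y (i + 1)]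

theorem confWidth_eq (z : ℕ → Z) (t : ℕ) (w : Z) :
    confWidth H lam z t w =
      √(inner ℝ (feature H w) (ridgeInv lam (pathFeature H z) (t - 1) (feature H w))) := by
  rw [confWidth, kvec_eq, gram_eq, inner_ridgeInv_self_eq hlam, kern_eq_inner,
    ← dotProduct_inv_mulVec_eq_inner_ridgeInv hlam (pathFeature H z) (feature H w)
      fun i => inner ℝ (feature H w) (pathFeature H z i)]

theorem infoGain_eq (z : ℕ → Z) (t : ℕ) :
    infoGain H lam z t = ∑ i ∈ Finset.range (t - 1), Real.log (1 +
      inner ℝ (pathFeature H z i) (ridgeInv lam (pathFeature H z) i (pathFeature H z i))) := by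
  rw [infoGain, gram_eq, log_det_one_add_gram_eq_sum hlam]

theorem infoGain_mono (z : ℕ → Z) {t t' : ℕ} (h : t ≤ t') :
    infoGain H lam z t ≤ infoGain H lam z t' := by
  rw [infoGain_eq H hlam, infoGain_eq H hlam]
  refine Finset.sum_le_sum_of_subset_of_nonneg
    (Finset.range_subset_range.2 (Nat.sub_le_sub_right h 1)) fun i _ _ => Real.log_nonneg ?_
  exact le_add_of_nonneg_right (inner_ridgeInv_self_nonneg hlam _ _ _)

theorem confRadius_mono (B δ : ℝ) {b : ℝ} (hb : 0 ≤ b) (z : ℕ → Z) {t t' : ℕ} (h : t ≤ t') :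
    confRadius H lam B b δ z t ≤ confRadius H lam B b δ z t' := by
  have := infoGain_mono H hlam z h
  unfold confRadius
  gcongr

theorem confWidth_le (z : ℕ → Z) (t : ℕ) {w : Z} (hw : ‖feature H w‖ ≤ 1) :
    confWidth H lam z t w ≤ 1 / √lam := by
  rw [confWidth_eq H hlam]
  refine (sqrt_inner_ridgeInv_le hlam _ _ _).trans ?_
  gcongr

theorem confWidth_le_add (z : ℕ → Z) (t : ℕ) (v w : Z) :
    confWidth H lam z t w ≤ confWidth H lam z t v + ‖feature H w - feature H v‖ / √lam := by
  rw [confWidth_eq H hlam, confWidth_eq H hlam]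
  have h := sqrt_inner_ridgeInv_add_le hlam (pathFeature H z) (t - 1) (feature H v)
    (feature H w - feature H v)
  rw [add_sub_cancel] at h
  exact h.trans (add_le_add le_rfl (sqrt_inner_ridgeInv_le hlam _ _ _))

/-- Confidence bound of round `t`, given that the noise of the past is bounded in the `V⁻¹`-norm. -/
theorem abs_estimate_sub_le {B b δ : ℝ} (hb : 0 ≤ b) {f : H} (hf : ‖f‖ ≤ B) (z : ℕ → Z)
    (y e : ℕ → ℝ) (t : ℕ) (hy : ∀ i < t - 1, y (i + 1) = f (z (i + 1)) + e i)
    (hnoise : inner ℝ (∑ j ∈ Finset.range (t - 1), e j • pathFeature H z j)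
        (ridgeInv lam (pathFeature H z) (t - 1)
          (∑ j ∈ Finset.range (t - 1), e j • pathFeature H z j)) ≤
      b ^ 2 * (infoGain H lam z t - 2 * Real.log δ)) (w : Z) :
    |estimate H lam z y t w - f w| ≤ confRadius H lam B b δ z t * confWidth H lam z t w := by
  have hsum : ∑ i ∈ Finset.range (t - 1), y (i + 1) • pathFeature H z i =
      ∑ i ∈ Finset.range (t - 1),
        (inner ℝ (pathFeature H z i) f + e i) • pathFeature H z i := by
    refine Finset.sum_congr rfl fun i hi => ?_
    rw [hy i (Finset.mem_range.1 hi), apply_eq_inner, pathFeature]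
  rw [estimate_eq H hlam, hsum, apply_eq_inner, confWidth_eq H hlam]
  refine (abs_ridge_sub_le hlam (pathFeature H z) (t - 1) f e (feature H w)).trans ?_
  unfold confRadius
  gcongr
  refine (Real.sqrt_le_sqrt hnoise).trans_eq ?_
  rw [Real.sqrt_mul (sq_nonneg b), Real.sqrt_sq hb]

end Primal

/-! ### The regret of one round -/

section Regret

variable {X A : Type*}

theorem bddAbove_range_of_le {ι : Type*} {g : ι → ℝ} {c : ℝ} (h : ∀ i, g i ≤ c) :
    BddAbove (Set.range g) :=
  ⟨c, Set.forall_mem_range.2 h⟩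

theorem bddBelow_range_of_le {ι : Type*} {g : ι → ℝ} {c : ℝ} (h : ∀ i, c ≤ g i) :
    BddBelow (Set.range g) :=
  ⟨c, Set.forall_mem_range.2 h⟩

theorem gap_nonneg {g : X × A → ℝ} {c : ℝ} (h : ∀ z, g z ≤ c) (a : A) (x : X) : 0 ≤ gap g a x :=
  sub_nonneg.2 (le_ciSup (f := fun a' => g (x, a')) (bddAbove_range_of_le fun _ => h _) a)

theorem gap_le {g : X × A → ℝ} {c c' : ℝ} (h : ∀ z, g z ≤ c) (h' : ∀ z, c' ≤ g z) (a : A) (x : X) :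
    gap g a x ≤ c - c' := by
  have : Nonempty A := ⟨a⟩
  exact sub_le_sub (ciSup_le fun _ => h _) (h' _)

theorem gap_le_worstGap {g : X × A → ℝ} {c c' : ℝ} (h : ∀ z, g z ≤ c) (h' : ∀ z, c' ≤ g z)
    {S : Set X} (a : A) {x : X} (hx : x ∈ S) : gap g a x ≤ worstGap S g a :=
  le_ciSup (f := fun x : S => gap g a x) (bddAbove_range_of_le fun _ => gap_le h h' _ _) ⟨x, hx⟩

theorem optWorstReward_le_iSup {f : X × A → ℝ} {c c' : ℝ} (h : ∀ z, f z ≤ c) (h' : ∀ z, c' ≤ f z)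
    {S : Set X} {x : X} (hx : x ∈ S) : optWorstReward S f ≤ ⨆ a, f (x, a) :=
  ciSup_mono (bddAbove_range_of_le fun _ => h _) fun _ =>
    ciInf_le (bddBelow_range_of_le fun _ => h' _) (⟨x, hx⟩ : S)

theorem optWorstRegret_nonneg {f : X × A → ℝ} {c : ℝ} (h : ∀ z, f z ≤ c) (S : Set X) :
    0 ≤ optWorstRegret S f :=
  Real.iInf_nonneg fun _ => Real.iSup_nonneg fun _ => gap_nonneg h _ _

theorem reward_ge_of_abs_le [Nonempty A] {f : X × A → ℝ} {F : ℝ} (hF : ∀ z, |f z| ≤ F) {S : Set X}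
    {x : X} (hx : x ∈ S) (a : A) :
    optWorstReward S f - optWorstRegret S f - 2 * F ≤ f (x, a) := by
  have h1 : ∀ z, f z ≤ F := fun z => (abs_le.1 (hF z)).2
  have h2 : ∀ z, -F ≤ f z := fun z => (abs_le.1 (hF z)).1
  have h3 := (optWorstReward_le_iSup h1 h2 hx).trans (ciSup_le fun _ => h1 _)
  have h4 := optWorstRegret_nonneg h1 S
  linarith [h2 (x, a)]

/-- The reward of a MinWD arm in one round: the worst-case degradation of the selected arm is at
most that of the arm with minimal worst-case regret, which is `MR` up to the confidence width at the
considered pair `w`. -/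
theorem reward_ge_of_isMinWDArm {f U d : X × A → ℝ} {F D : ℝ} (hF : ∀ z, |f z| ≤ F)
    (hD : ∀ z, d z ≤ D) (hlo : ∀ z, f z ≤ U z) (hhi : ∀ z, U z ≤ f z + 2 * d z) {S : Set X} {x : X}
    (hx : x ∈ S) {a : A} (ha : IsMinWDArm S U a) {w : X × A} (hw : IsConsideredPair S f U w) :
    optWorstReward S f - optWorstRegret S f - 2 * d w - 2 * d (x, a) ≤ f (x, a) := by
  obtain ⟨a₀, ha₀, hwS, hwmax, hwarm⟩ := hw
  have : Nonempty A := ⟨a⟩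
  have : Nonempty S := ⟨⟨x, hx⟩⟩
  have h1 : ∀ z, f z ≤ F := fun z => (abs_le.1 (hF z)).2
  have h2 : ∀ z, -F ≤ f z := fun z => (abs_le.1 (hF z)).1
  have hU1 : ∀ z, U z ≤ F + 2 * D := fun z => by linarith [hhi z, h1 z, hD z]
  have hU2 : ∀ z, -F ≤ U z := fun z => (h2 z).trans (hlo z)
  have hsup : ⨆ a', f (x, a') ≤ ⨆ a', U (x, a') :=
    ciSup_mono (bddAbove_range_of_le fun _ => hU1 _) fun _ => hlo _
  have hgap : gap U a x ≤ gap U a₀ w.1 :=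
    (gap_le_worstGap hU1 hU2 a hx).trans <| (isMinOn_univ_iff.1 ha a₀).trans <|
      ciSup_le fun x' => isMaxOn_iff.1 hwmax x' x'.2
  have hattain : ⨆ a', U (w.1, a') ≤ U w := ciSup_le fun a' => isMaxOn_univ_iff.1 hwarm a'
  have hregret : gap f a₀ w.1 ≤ optWorstRegret S f :=
    (gap_le_worstGap h1 h2 a₀ hwS).trans (le_ciInf fun a' => isMinOn_univ_iff.1 ha₀ a')
  have hsupw : f w ≤ ⨆ a', f (w.1, a') :=
    le_ciSup (f := fun a' => f (w.1, a')) (bddAbove_range_of_le fun _ => h1 _) w.2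
  have hreward := optWorstReward_le_iSup h1 h2 hx
  unfold gap at hgap hregret
  linarith [hhi (x, a), hhi w, hlo (w.1, a₀)]

end Regret

/-! ### Matching rounds with later visits of the same cell -/

section Matching

variable {p q : ℕ} {X : Set (EuclideanSpace ℝ (Fin p))} {A : Set (EuclideanSpace ℝ (Fin q))}

/-- Every window of `N` rounds contains a visit of every cell: when the window leaves a visit
behind, that visit is followed by another within `N` rounds. -/
theorem exists_visit {ε : ℝ} {C : Finset (X × A)} {N : ℕ} {z : ℕ → X × A}
    (hz : Recurrent ε C N z) {c : X × A} (hc : c ∈ C) {t : ℕ} (ht : 1 ≤ t) :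
    ∃ s, t ≤ s ∧ s < t + N ∧ z s ∈ cell ε c := by
  induction t, ht using Nat.le_induction with
  | base =>
    obtain ⟨s, h1, h2, h3⟩ := hz.1 c hc
    exact ⟨s, h1, by omega, h3⟩
  | succ t ht ih =>
    obtain ⟨s, h1, h2, h3⟩ := ih
    rcases h1.eq_or_lt with rfl | h1
    · obtain ⟨s', h4, h5, h6⟩ := hz.2 t ht c hc h3
      exact ⟨s', h4, by omega, h6⟩
    · exact ⟨s, h1, by omega, h3⟩

theorem exists_isMatching {ε : ℝ} {C : Finset (X × A)} (hC : IsCovering ε C) {N : ℕ} (T : ℕ)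
    {z : ℕ → X × A} (hz : Recurrent ε C N z) (w : ℕ → X × A) :
    ∃ ζ : ℕ → ℕ, IsMatching ε C N T z w ζ := by
  have h : ∀ t, ∃ s, 1 ≤ t → t ≤ s ∧ s < t + N ∧ ∃ c ∈ C, w t ∈ cell ε c ∧ z s ∈ cell ε c := by
    intro t
    by_cases ht : 1 ≤ t
    · obtain ⟨c, hc, hw⟩ := hC (w t)
      obtain ⟨s, h1, h2, h3⟩ := exists_visit hz hc ht
      exact ⟨s, fun _ => ⟨h1, h2, c, hc, hw, h3⟩⟩
    · exact ⟨0, fun h => absurd h ht⟩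
  choose ζ hζ using h
  exact ⟨ζ, fun t ht _ => hζ t ht⟩

theorem norm_concat_sub_le {ε : ℝ} {c v w : X × A} (hv : v ∈ cell ε c) (hw : w ∈ cell ε c) :
    ‖concat w - concat v‖ ≤ 2 * ε := by
  have hv : ‖concat v - concat c‖ ≤ ε := hv
  have hw : ‖concat w - concat c‖ ≤ ε := hw
  calc ‖concat w - concat v‖ = ‖(concat w - concat c) - (concat v - concat c)‖ := by
        rw [sub_sub_sub_cancel_right]
    _ ≤ ‖concat w - concat c‖ + ‖concat v - concat c‖ := norm_sub_le _ _
    _ ≤ 2 * ε := by linarith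

end Matching

/-! ### Sums of confidence widths -/

section Sums

variable {Z : Type*} (H : Type*) [NormedAddCommGroup H] [InnerProductSpace ℝ H] [CompleteSpace H]
  [RKHS ℝ H Z ℝ]

theorem norm_feature_le_one (hk : ∀ z : Z, kern H z z ≤ 1) (z : Z) : ‖feature H z‖ ≤ 1 := by
  have h := hk z
  rw [kern_eq_inner, real_inner_self_eq_norm_sq] at h
  exact (sq_le_one_iff₀ (norm_nonneg _)).1 h

theorem confWidth_sq {lam : ℝ} (hlam : 0 < lam) (z : ℕ → Z) (t : ℕ) (w : Z) :
    confWidth H lam z t w ^ 2 =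
      inner ℝ (feature H w) (ridgeInv lam (pathFeature H z) (t - 1) (feature H w)) := by
  rw [confWidth_eq H hlam, Real.sq_sqrt (inner_ridgeInv_self_nonneg hlam _ _ _)]

theorem sum_confWidth_self_sq_le {lam : ℝ} (hlam : 1 ≤ lam) (hk : ∀ z : Z, kern H z z ≤ 1)
    (z : ℕ → Z) (T : ℕ) :
    ∑ i ∈ Finset.range (T - 1), confWidth H lam z (i + 1) (z (i + 1)) ^ 2 ≤
      2 * ((gram H z T).rank * Real.log (1 + T / ((gram H z T).rank * lam))) := by
  have hl : 0 < lam := by linarith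
  simp only [confWidth_sq H hl]
  refine (sum_inner_ridgeInv_le hlam (pathFeature H z) (T - 1) fun i _ =>
    norm_feature_le_one H hk _).trans ?_
  rw [← gram_eq]
  have h1 : ((T - 1 : ℕ) : ℝ) ≤ T := by exact_mod_cast Nat.sub_le T 1
  gcongr

/-- Within a group of rounds `l, l + N, l + 2 N, …`, the matched pairs of the earlier rounds of the
group are distinct past observations, so the widths are at most those of the regression that uses
these observations only. -/
theorem sum_group_confWidth_sq_le {lam : ℝ} (hlam : 1 ≤ lam) (hk : ∀ z : Z, kern H z z ≤ 1)
    (z : ℕ → Z) (ζ : ℕ → ℕ) {N M l : ℕ} (hl : 1 ≤ l)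
    (hζ : ∀ j < M, l + j * N ≤ ζ (l + j * N) ∧ ζ (l + j * N) < l + (j + 1) * N) :
    ∑ j ∈ Finset.range M, confWidth H lam z (l + j * N) (z (ζ (l + j * N))) ^ 2 ≤
      2 * ((Matrix.of fun i j : Fin M =>
          kern H (z (ζ (l + i * N))) (z (ζ (l + j * N)))).rank *
        Real.log (1 + M / ((Matrix.of fun i j : Fin M =>
          kern H (z (ζ (l + i * N))) (z (ζ (l + j * N)))).rank * lam))) := by
  have hlam0 : 0 < lam := by linarith
  set ψ : ℕ → H := fun j => feature H (z (ζ (l + j * N))) with hψ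
  have hgram : (Matrix.of fun i j : Fin M => kern H (z (ζ (l + i * N))) (z (ζ (l + j * N)))) =
      Matrix.gram ℝ fun i : Fin M => ψ i := by
    ext i j
    simp [kern_eq_inner, Matrix.gram_apply, hψ]
  rw [hgram]
  refine le_trans (Finset.sum_le_sum fun j hj => ?_) (sum_inner_ridgeInv_le hlam ψ M fun i _ =>
    norm_feature_le_one H hk _)
  rw [confWidth_sq H hlam0]
  have hj : j < M := Finset.mem_range.1 hj
  refine inner_ridgeInv_self_anti hlam0 _ _ ψ j _ fun u => ?_
  have hmono : ∀ i < j, ∀ i' < i, ζ (l + i' * N) < ζ (l + i * N) := fun i hi i' hi' => by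
    have h1 := (hζ i' (by omega)).2
    have h2 := (hζ i (by omega)).1
    have : (i' + 1) * N ≤ i * N := Nat.mul_le_mul_right N hi'
    omega
  have hinj : Set.InjOn (fun i => ζ (l + i * N) - 1) (Finset.range j : Set ℕ) := by
    intro i hi i' hi' h
    have hi : i < j := by simpa using hi
    have hi' : i' < j := by simpa using hi'
    have h1 := (hζ i (by omega)).1
    have h2 := (hζ i' (by omega)).1
    have h : ζ (l + i * N) - 1 = ζ (l + i' * N) - 1 := h
    by_contra hne
    rcases Nat.lt_or_gt_of_ne hne with hlt | hlt
    · have := hmono i' hi' i hlt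
      omega
    · have := hmono i hi i' hlt
      omega
  have hterm : ∀ i ∈ Finset.range j, inner ℝ (ψ i) u ^ 2 =
      inner ℝ (pathFeature H z (ζ (l + i * N) - 1)) u ^ 2 := fun i hi => by
    have h1 := (hζ i ((Finset.mem_range.1 hi).trans hj)).1
    rw [pathFeature, Nat.sub_add_cancel (by omega)]
  rw [Finset.sum_congr rfl hterm,
    ← Finset.sum_image (g := fun i => ζ (l + i * N) - 1)
      (f := fun i => inner ℝ (pathFeature H z i) u ^ 2) hinj]
  refine Finset.sum_le_sum_of_subset_of_nonneg (fun k hk => ?_) fun _ _ _ => sq_nonneg _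
  obtain ⟨i, hi, rfl⟩ := Finset.mem_image.1 hk
  have hi : i < j := Finset.mem_range.1 hi
  have h1 := (hζ i (by omega)).1
  have h2 := (hζ i (by omega)).2
  have : (i + 1) * N ≤ j * N := Nat.mul_le_mul_right N hi
  rw [Finset.mem_range]
  omega

theorem sum_range_mul_eq (g : ℕ → ℝ) (M N : ℕ) :
    ∑ i ∈ Finset.range (M * N), g i =
      ∑ l ∈ Finset.range N, ∑ j ∈ Finset.range M, g (l + j * N) := by
  induction M with
  | zero => simp
  | succ M ih =>
    rw [Nat.succ_mul, Finset.sum_range_add, ih, ← Finset.sum_add_distrib]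
    exact Finset.sum_congr rfl fun l _ => by rw [Finset.sum_range_succ, add_comm l]

/-- The widths at the matched pairs over all complete groups of rounds. -/
theorem sum_confWidth_matched_sq_le {lam : ℝ} (hlam : 1 ≤ lam) (hk : ∀ z : Z, kern H z z ≤ 1)
    (z : ℕ → Z) (ζ : ℕ → ℕ) {N M : ℕ}
    (hζ : ∀ t, 1 ≤ t → t ≤ M * N → t ≤ ζ t ∧ ζ t < t + N) :
    ∑ i ∈ Finset.range (M * N), confWidth H lam z (i + 1) (z (ζ (i + 1))) ^ 2 ≤
      N * (2 * (effDim H z ζ N M * Real.log (1 + M / (effDim H z ζ N M * lam)))) := by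
  have hlam0 : 0 < lam := by linarith
  rw [sum_range_mul_eq]
  refine (Finset.sum_le_card_nsmul _ _ _ fun l hl => ?_).trans_eq
    (by rw [Finset.card_range, nsmul_eq_mul])
  have hl : l < N := Finset.mem_range.1 hl
  have hbound : ∀ j < M, l + 1 + j * N ≤ ζ (l + 1 + j * N) ∧
      ζ (l + 1 + j * N) < l + 1 + (j + 1) * N := fun j hj => by
    have : (j + 1) * N ≤ M * N := Nat.mul_le_mul_right N hj
    have h := hζ (l + 1 + j * N) (by omega) (by rw [Nat.succ_mul] at this; omega)
    rw [Nat.succ_mul]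
    omega
  have h1 := sum_group_confWidth_sq_le H hlam hk z ζ (N := N) (M := M) (l := l + 1)
    (by omega) hbound
  have hrank : (Matrix.of fun i j : Fin M =>
      kern H (z (ζ (l + 1 + i * N))) (z (ζ (l + 1 + j * N)))).rank ≤ effDim H z ζ N M :=
    Finset.le_sup (f := fun l => (Matrix.of fun i j : Fin M =>
      kern H (z (ζ (l + i * N))) (z (ζ (l + j * N)))).rank) (Finset.mem_Icc.2 ⟨by omega, by omega⟩)
  have hmono := mul_log_one_add_div_mono (c := M / lam) (by positivity) (Nat.cast_nonneg _)
    (Nat.cast_le.2 hrank)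
  simp only [div_div, mul_comm lam] at hmono
  refine le_trans (le_of_eq (Finset.sum_congr rfl fun j _ => ?_)) (h1.trans (by gcongr))
  rw [add_right_comm]

theorem sum_le_sqrt_mul_sum_sq (u : ℕ → ℝ) (n : ℕ) {Q : ℝ}
    (h : ∑ i ∈ Finset.range n, u i ^ 2 ≤ Q) : ∑ i ∈ Finset.range n, u i ≤ √(n * Q) := by
  refine Real.le_sqrt_of_sq_le ?_
  have := sq_sum_le_card_mul_sum_sq (s := Finset.range n) (f := u)
  rw [Finset.card_range] at this
  exact this.trans (by gcongr)

/-- Widths at the matched pairs, with the last round counted at the largest possible width. The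
rounds outside the complete groups, together with the last round, are at most `√T` in number. -/
theorem sum_confWidth_matched_le {lam : ℝ} (hlam : 1 ≤ lam) (hk : ∀ z : Z, kern H z z ≤ 1)
    (z : ℕ → Z) (ζ : ℕ → ℕ) {N T : ℕ} (hT : 1 ≤ T) (hN : N = ⌈√(T : ℝ)⌉₊)
    (hζ : ∀ t, 1 ≤ t → t ≤ T → t ≤ ζ t ∧ ζ t < t + N) :
    ∑ i ∈ Finset.range T, (if i + 1 < T then confWidth H lam z (i + 1) (z (ζ (i + 1)))
        else 1 / √lam) ≤
      (T : ℝ) ^ (3 / 4 : ℝ) * √(4 * effDim H z ζ N (T / N) *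
        Real.log (1 + T / (effDim H z ζ N (T / N) * lam)) + 1 / lam) := by
  have hlam0 : 0 < lam := by linarith
  have hT' : (1 : ℝ) ≤ T := by exact_mod_cast hT
  have hsT : 1 ≤ √(T : ℝ) := Real.one_le_sqrt.2 hT'
  set M := T / N with hM
  set dt : ℝ := ((effDim H z ζ N M : ℕ) : ℝ) with hdt
  have hNlt : (N : ℝ) < √T + 1 := by rw [hN]; exact Nat.ceil_lt_add_one (by positivity)
  have hN0 : 0 < N := by rw [hN]; exact Nat.ceil_pos.2 (by positivity)
  have hMN : M * N ≤ T := Nat.div_mul_le_self T N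
  have hMN' : T < M * N + N := Nat.lt_div_mul_add hN0
  have hMT : (M : ℝ) ≤ T := by exact_mod_cast Nat.div_le_self T N
  set g : ℕ → ℝ := fun i => confWidth H lam z (i + 1) (z (ζ (i + 1))) with hg
  set k := min (M * N) (T - 1) with hkdef
  have hkT : k ≤ T := by omega
  have hg2 : ∀ i, g i ^ 2 ≤ 1 / lam := fun i => by
    have h1 : g i ≤ 1 / √lam := confWidth_le H hlam0 z _ (norm_feature_le_one H hk _)
    calc g i ^ 2 ≤ (1 / √lam) ^ 2 := pow_le_pow_left₀ (Real.sqrt_nonneg _) h1 2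
      _ = 1 / lam := by rw [div_pow, Real.sq_sqrt hlam0.le, one_pow]
  set L := Real.log (1 + T / (dt * lam)) with hL
  have hL0 : 0 ≤ L := Real.log_nonneg (le_add_of_nonneg_right (by positivity))
  have hcomplete : ∑ i ∈ Finset.range k, g i ^ 2 ≤ N * (2 * (dt * L)) := by
    refine (Finset.sum_le_sum_of_subset_of_nonneg
      (Finset.range_subset_range.2 (min_le_left _ _)) fun _ _ _ => sq_nonneg _).trans ?_
    refine (sum_confWidth_matched_sq_le H hlam hk z ζ fun t h1 h2 =>
      hζ t h1 (h2.trans hMN)).trans ?_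
    have hlog : Real.log (1 + M / (dt * lam)) ≤ L :=
      Real.log_le_log (by positivity) (by gcongr)
    gcongr
  have hcount : ((T - k : ℕ) : ℝ) ≤ √T := by
    rcases le_or_gt (T - k) 1 with h | h
    · exact (by exact_mod_cast h : ((T - k : ℕ) : ℝ) ≤ 1).trans hsT
    · have : T - k + 1 ≤ N := by omega
      have : ((T - k : ℕ) : ℝ) + 1 ≤ N := by exact_mod_cast this
      linarith
  have hsq : ∑ i ∈ Finset.range T, (if i + 1 < T then g i else 1 / √lam) ^ 2 ≤
      √T * (4 * dt * L + 1 / lam) := by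
    rw [← Finset.sum_range_add_sum_Ico _ hkT]
    have h1 : ∑ i ∈ Finset.range k, (if i + 1 < T then g i else 1 / √lam) ^ 2 =
        ∑ i ∈ Finset.range k, g i ^ 2 := Finset.sum_congr rfl fun i hi => by
      have : i < k := Finset.mem_range.1 hi
      rw [if_pos (by omega)]
    have h2 : ∑ i ∈ Finset.Ico k T, (if i + 1 < T then g i else 1 / √lam) ^ 2 ≤ √T * (1 / lam) := by
      refine (Finset.sum_le_card_nsmul _ _ (1 / lam) fun i _ => ?_).trans ?_
      · split_ifs
        · exact hg2 i
        · rw [div_pow, Real.sq_sqrt hlam0.le, one_pow]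
      · rw [Nat.card_Ico, nsmul_eq_mul]
        gcongr
    have h3 : N * (2 * (dt * L)) ≤ (2 * √T) * (2 * (dt * L)) := by
      gcongr
      linarith
    rw [h1]
    linarith
  refine (sum_le_sqrt_mul_sum_sq _ T hsq).trans_eq ?_
  rw [← mul_assoc, Real.sqrt_mul (by positivity)]
  congr 1
  rw [Real.sqrt_eq_rpow, Real.sqrt_eq_rpow, ← Real.rpow_one_add' (by positivity) (by norm_num),
    ← Real.rpow_mul (by positivity)]
  norm_num

end Sums

/-! ### The covering radius -/

theorem coverRadius_nonneg (κ : ℝ) (d T : ℕ) : 0 ≤ coverRadius κ d T :=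
  Real.rpow_nonneg (by positivity) _

theorem coverRadius_eq {κ : ℝ} (hκ : 0 ≤ κ) (d T : ℕ) :
    coverRadius κ d T = κ ^ (1 / (d : ℝ)) / (T : ℝ) ^ (1 / (2 * (d : ℝ))) := by
  rw [coverRadius, Real.div_rpow (sq_nonneg κ) (Nat.cast_nonneg T), ← Real.rpow_natCast,
    ← Real.rpow_mul hκ]
  congr 2
  rcases eq_or_ne (d : ℝ) 0 with h | h
  · simp [h]
  · push_cast
    field_simp

theorem coverRadius_pow {κ : ℝ} (hκ : 0 ≤ κ) {d : ℕ} (hd : 0 < d) (T : ℕ) :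
    coverRadius κ d T ^ d = κ / √T := by
  have hd' : (d : ℝ) ≠ 0 := by exact_mod_cast hd.ne'
  rw [coverRadius_eq hκ, div_pow, ← Real.rpow_natCast, ← Real.rpow_natCast, ← Real.rpow_mul hκ,
    ← Real.rpow_mul (Nat.cast_nonneg T), Real.sqrt_eq_rpow, one_div_mul_cancel hd', Real.rpow_one]
  congr 2
  field_simp

theorem mul_coverRadius {κ : ℝ} (hκ : 0 ≤ κ) (d : ℕ) {T : ℕ} (hT : 1 ≤ T) :
    T * coverRadius κ d T = κ ^ (1 / (d : ℝ)) * (T : ℝ) ^ (1 - 1 / (2 * (d : ℝ))) := by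
  have hT' : (0 : ℝ) < T := by exact_mod_cast hT
  rw [coverRadius_eq hκ, Real.rpow_sub hT', Real.rpow_one]
  ring

theorem numGroups_coverRadius {κ : ℝ} (hκ : 0 < κ) {d : ℕ} (hd : 0 < d) (T : ℕ) :
    numGroups κ (coverRadius κ d T) d = ⌈√(T : ℝ)⌉₊ := by
  rw [numGroups, coverRadius_pow hκ.le hd, div_div_cancel₀ hκ.ne']

theorem numGroups_zero (ε : ℝ) (d : ℕ) : numGroups 0 ε d = 0 := by simp [numGroups]

/-! ### The cumulative reward along a path -/

section Path

variable {p q : ℕ} {X : Set (EuclideanSpace ℝ (Fin p))} {A : Set (EuclideanSpace ℝ (Fin q))}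
  {H : Type*} [NormedAddCommGroup H] [InnerProductSpace ℝ H] [CompleteSpace H]
  [RKHS ℝ H (X × A) ℝ]

theorem sum_Icc_one_eq_sum_range (g : ℕ → ℝ) (T : ℕ) :
    ∑ t ∈ Finset.Icc 1 T, g t = ∑ i ∈ Finset.range T, g (i + 1) := by
  rw [Finset.range_eq_Ico, Finset.sum_Ico_add' g 0 T 1]
  rfl

/-- Reward of round `t`, up to the width at the selected pair, the width at a later visit `v` of the
cell of the considered pair, and the Lipschitz error of moving the considered pair to `v`. -/
theorem reward_ge_of_confidence {f : H} {B lam b δ L ε : ℝ} (hB : ‖f‖ ≤ B) (hlam : 0 < lam)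
    (hb : 0 ≤ b) (hk : ∀ z : X × A, kern H z z ≤ 1) (hL : 0 ≤ L)
    (hLip : ∀ z w : X × A, ‖feature H z - feature H w‖ ≤ L * ‖concat z - concat w‖)
    (z : ℕ → X × A) (y : ℕ → ℝ) {S : Set X} {t T : ℕ} (htT : t ≤ T)
    (hconf : ∀ w, |estimate H lam z y t w - f w| ≤
      confRadius H lam B b δ z t * confWidth H lam z t w)
    (hS : (z t).1 ∈ S) (ha : IsMinWDArm S (ucb H lam B b δ z y t) (z t).2)
    {w : X × A} (hw : IsConsideredPair S f (ucb H lam B b δ z y t) w)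
    {C : Finset (X × A)} {v : X × A} (hv : ∃ c ∈ C, w ∈ cell ε c ∧ v ∈ cell ε c) :
    optWorstReward S f - optWorstRegret S f - 2 * confRadius H lam B b δ z T *
      (confWidth H lam z t (z t) + confWidth H lam z t v + 2 * L * ε / √lam) ≤ f (z t) := by
  have hfeat := norm_feature_le_one H hk
  have hB0 : 0 ≤ B := (norm_nonneg f).trans hB
  have hf : ∀ z, |f z| ≤ B := fun z => by
    rw [apply_eq_inner]
    exact (abs_real_inner_le_norm _ _).trans
      ((mul_le_of_le_one_left (norm_nonneg _) (hfeat z)).trans hB)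
  have hh0 : 0 ≤ confRadius H lam B b δ z t := by unfold confRadius; positivity
  have hhT := confRadius_mono H hlam B δ hb z htT
  have hround := reward_ge_of_isMinWDArm (f := f) (U := ucb H lam B b δ z y t)
    (d := fun w => confRadius H lam B b δ z t * confWidth H lam z t w) hf
    (D := confRadius H lam B b δ z t * (1 / √lam))
    (fun w => mul_le_mul_of_nonneg_left (confWidth_le H hlam z t (hfeat w)) hh0)
    (fun w => by have := (abs_le.1 (hconf w)).1; unfold ucb; linarith)
    (fun w => by have := (abs_le.1 (hconf w)).2; unfold ucb; linarith) hS ha hw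
  have hwidth : confWidth H lam z t w ≤ confWidth H lam z t v + 2 * L * ε / √lam := by
    obtain ⟨c, -, hwc, hvc⟩ := hv
    refine (confWidth_le_add H hlam z t v w).trans ?_
    gcongr
    calc ‖feature H w - feature H v‖ ≤ L * ‖concat w - concat v‖ := hLip w v
      _ ≤ L * (2 * ε) := by gcongr; exact norm_concat_sub_le hvc hwc
      _ = 2 * L * ε := by ring
  have h1 : confRadius H lam B b δ z t * confWidth H lam z t w ≤
      confRadius H lam B b δ z T * (confWidth H lam z t v + 2 * L * ε / √lam) :=
    mul_le_mul hhT hwidth (Real.sqrt_nonneg _) (hh0.trans hhT)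
  have h2 : confRadius H lam B b δ z t * confWidth H lam z t (z t) ≤
      confRadius H lam B b δ z T * confWidth H lam z t (z t) :=
    mul_le_mul_of_nonneg_right hhT (Real.sqrt_nonneg _)
  have hround : optWorstReward S f - optWorstRegret S f -
    2 * (confRadius H lam B b δ z t * confWidth H lam z t w) -
    2 * (confRadius H lam B b δ z t * confWidth H lam z t (z t)) ≤ f (z t) := hround
  linarith

/-- The cumulative reward along a path on which the confidence bounds hold. The last round is
bounded trivially, by the range of `f`: its observation does not enter the kernel matrix `K_T`. -/
theorem sum_reward_ge {f : H} {B lam b δ L κ : ℝ} (hB : ‖f‖ ≤ B) (hlam : 1 ≤ lam)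
    (hb : 0 ≤ b) (hk : ∀ z : X × A, kern H z z ≤ 1) (hL : 0 ≤ L)
    (hLip : ∀ z w : X × A, ‖feature H z - feature H w‖ ≤ L * ‖concat z - concat w‖)
    (z : ℕ → X × A) (y : ℕ → ℝ) (S : ℕ → Set X) {T : ℕ} (hT : 1 ≤ T)
    (hconf : ∀ t, 1 ≤ t → t ≤ T → ∀ w, |estimate H lam z y t w - f w| ≤
      confRadius H lam B b δ z t * confWidth H lam z t w)
    (hS : ∀ t, 1 ≤ t → t ≤ T → (z t).1 ∈ S t)
    (ha : ∀ t, 1 ≤ t → t ≤ T → IsMinWDArm (S t) (ucb H lam B b δ z y t) (z t).2)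
    (w : ℕ → X × A)
    (hw : ∀ t, 1 ≤ t → t ≤ T → IsConsideredPair (S t) f (ucb H lam B b δ z y t) (w t))
    (hκ : 0 ≤ κ) {d N : ℕ} (hN : N = ⌈√(T : ℝ)⌉₊) {C : Finset (X × A)} {ζ : ℕ → ℕ}
    (hζ : IsMatching (coverRadius κ d T) C N T z w ζ) :
    ∑ t ∈ Finset.Icc 1 T, (optWorstReward (S t) f - optWorstRegret (S t) f)
        - 2 * confRadius H lam B b δ z T * (T : ℝ) ^ (3 / 4 : ℝ)
            * √(4 * effDim H z ζ N (T / N) *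
              Real.log (1 + T / (effDim H z ζ N (T / N) * lam)) + 1 / lam)
        - 4 * √(2 / lam) * L * κ ^ (1 / (d : ℝ)) * confRadius H lam B b δ z T
            * (T : ℝ) ^ (1 - 1 / (2 * (d : ℝ)))
        - 2 * confRadius H lam B b δ z T *
            √(2 * T * (gram H z T).rank * Real.log (1 + T / ((gram H z T).rank * lam)))
      ≤ ∑ t ∈ Finset.Icc 1 T, f (z t) := by
  have hlam0 : 0 < lam := by linarith
  have hsl : 0 < √lam := Real.sqrt_pos.2 hlam0
  have hfeat := norm_feature_le_one H hk
  have hB0 : 0 ≤ B := (norm_nonneg f).trans hB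
  set h := confRadius H lam B b δ z T with hh
  set ε := coverRadius κ d T with hε
  have hε0 : 0 ≤ ε := coverRadius_nonneg κ d T
  have hhB : √lam * B ≤ h := by
    rw [hh, confRadius]
    exact le_add_of_nonneg_right (by positivity)
  have hh0 : 0 ≤ h := le_trans (by positivity) hhB
  set α : ℕ → ℝ := fun i => if i + 1 < T then confWidth H lam z (i + 1) (z (i + 1)) else 0 with hα
  set u : ℕ → ℝ := fun i =>
    if i + 1 < T then confWidth H lam z (i + 1) (z (ζ (i + 1))) else 1 / √lam with hu
  set η : ℝ := 2 * L * ε / √lam with hη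
  have hround : ∀ i ∈ Finset.range T, optWorstReward (S (i + 1)) f - optWorstRegret (S (i + 1)) f -
      2 * h * (α i + u i + η) ≤ f (z (i + 1)) := fun i hi => by
    have hi : i < T := Finset.mem_range.1 hi
    have h1 : 1 ≤ i + 1 := by omega
    by_cases hlt : i + 1 < T
    · simp only [hα, hu, hlt, if_true]
      exact reward_ge_of_confidence hB hlam0 hb hk hL hLip z y hi (hconf _ h1 hi) (hS _ h1 hi)
        (ha _ h1 hi) (hw _ h1 hi) (hζ _ h1 hi).2.2
    · simp only [hα, hu, hlt, if_false]
      have hf : ∀ z, |f z| ≤ B := fun z => by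
        rw [apply_eq_inner]
        exact (abs_real_inner_le_norm _ _).trans
          ((mul_le_of_le_one_left (norm_nonneg _) (hfeat z)).trans hB)
      have : Nonempty A := ⟨(z 0).2⟩
      have hlast := reward_ge_of_abs_le hf (hS _ h1 hi) (z (i + 1)).2
      have hBh : B ≤ h * (1 / √lam) := by
        rw [mul_one_div, le_div_iff₀ hsl]
        linarith
      have hη0 : 0 ≤ h * η := by positivity
      have hlast : optWorstReward (S (i + 1)) f - optWorstRegret (S (i + 1)) f - 2 * B ≤
        f (z (i + 1)) := hlast
      linarith
  have hsum := Finset.sum_le_sum hround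
  rw [Finset.sum_sub_distrib, ← Finset.mul_sum, Finset.sum_add_distrib, Finset.sum_add_distrib,
    Finset.sum_const, Finset.card_range, nsmul_eq_mul] at hsum
  have hαsum : ∑ i ∈ Finset.range T, α i ≤
      √(2 * T * (gram H z T).rank * Real.log (1 + T / ((gram H z T).rank * lam))) := by
    obtain ⟨n, rfl⟩ : ∃ n, T = n + 1 := ⟨T - 1, by omega⟩
    have h0 : ∑ i ∈ Finset.range (n + 1), α i =
        ∑ i ∈ Finset.range n, confWidth H lam z (i + 1) (z (i + 1)) := by
      rw [Finset.sum_range_succ, show α n = 0 by simp [hα], add_zero]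
      refine Finset.sum_congr rfl fun i hi => ?_
      have : i + 1 < n + 1 := by simpa using hi
      simp only [hα, this, if_true]
    rw [h0]
    have hsq := sum_confWidth_self_sq_le H hlam hk z (n + 1)
    refine (sum_le_sqrt_mul_sum_sq _ n hsq).trans (Real.sqrt_le_sqrt ?_)
    have hlog : 0 ≤ Real.log (1 + (n + 1 : ℕ) / ((gram H z (n + 1)).rank * lam)) :=
      Real.log_nonneg (le_add_of_nonneg_right (by positivity))
    calc _ ≤ ((n + 1 : ℕ) : ℝ) * (2 * ((gram H z (n + 1)).rank *
          Real.log (1 + (n + 1 : ℕ) / ((gram H z (n + 1)).rank * lam)))) := by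
          gcongr
          exact n.le_succ
      _ = _ := by ring
  have husum := sum_confWidth_matched_le H hlam hk z ζ hT hN fun t h1 h2 =>
    ⟨(hζ t h1 h2).1, (hζ t h1 h2).2.1⟩
  have hηsum : T * η ≤ 2 * √(2 / lam) * L * κ ^ (1 / (d : ℝ)) *
      (T : ℝ) ^ (1 - 1 / (2 * (d : ℝ))) := by
    have h1 : 1 / √lam ≤ √(2 / lam) := by
      rw [← Real.sqrt_one, ← Real.sqrt_div zero_le_one]
      gcongr
      norm_num
    calc T * η = 2 * (1 / √lam) * L * (T * ε) := by rw [hη]; ring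
      _ ≤ 2 * √(2 / lam) * L * (T * ε) := by gcongr
      _ = _ := by rw [hε, mul_coverRadius hκ d hT]; ring
  rw [sum_Icc_one_eq_sum_range, sum_Icc_one_eq_sum_range]
  have := mul_le_mul_of_nonneg_left (add_le_add (add_le_add hαsum husum) hηsum)
    (show 0 ≤ 2 * h by positivity)
  linarith

end Path

/-- The kernel evaluated at random pairs is measurable, since a Lipschitz feature map is
continuous. -/
theorem measurable_inner_feature {p q : ℕ} {X : Set (EuclideanSpace ℝ (Fin p))}
    {A : Set (EuclideanSpace ℝ (Fin q))} {H : Type*} [NormedAddCommGroup H]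
    [InnerProductSpace ℝ H] [CompleteSpace H] [RKHS ℝ H (X × A) ℝ] {L : ℝ}
    (hLip : ∀ z w : X × A, ‖feature H z - feature H w‖ ≤ L * ‖concat z - concat w‖)
    {Ω : Type*} {m : MeasurableSpace Ω} {z w : Ω → X × A} (hz : Measurable z)
    (hw : Measurable w) : Measurable fun ω => inner ℝ (feature H (z ω)) (feature H (w ω)) := by
  have hconcat : Continuous (concat : X × A → _) := by
    unfold concat
    fun_prop
  have hcont : Continuous (feature H : X × A → H) := by
    refine continuous_iff_continuousAt.2 fun z₀ => tendsto_iff_norm_sub_tendsto_zero.2 ?_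
    have h : Continuous fun z => L * ‖concat z - concat z₀‖ :=
      ((hconcat.sub continuous_const).norm).const_mul L
    have h0 := h.tendsto z₀
    rw [sub_self, norm_zero, mul_zero] at h0
    exact squeeze_zero (fun _ => norm_nonneg _) (fun z => hLip z z₀) h0
  have hk : Continuous fun v : (X × A) × (X × A) => inner ℝ (feature H v.1) (feature H v.2) :=
    (hcont.comp continuous_fst).inner (hcont.comp continuous_snd)
  have hkm : Measurable fun v : (X × A) × (X × A) =>
      inner ℝ (feature H v.1) (feature H v.2) := hk.measurable
  have hzw : Measurable fun ω => (z ω, w ω) := hz.prodMk hw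
  have h := hkm.comp hzw
  exact h

end RobustBandit

theorem mainTheorem5
    {p q : ℕ} (hd : 0 < p + q)
    -- contexts `X ⊆ ℝ^p`, arms `A ⊆ ℝ^q`, and the norm and budget for context errors
    (X : Set (EuclideanSpace ℝ (Fin p))) (A : Set (EuclideanSpace ℝ (Fin q)))
    (nrm : Seminorm ℝ (EuclideanSpace ℝ (Fin p))) (hnrm : ∀ v, nrm v = 0 → v = 0) (Δ : ℝ)
    -- the RKHS on `X × A` and the reward function `f`
    {H : Type*} [NormedAddCommGroup H] [InnerProductSpace ℝ H] [CompleteSpace H]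
    [RKHS ℝ H (X × A) ℝ]
    (f : H) (B : ℝ) (hB : ‖f‖ ≤ B)
    (hk : ∀ z : X × A, kern H z z ≤ 1)
    (L : ℝ) (hL : 0 ≤ L)
    (hLip : ∀ z w : X × A, ‖feature H z - feature H w‖ ≤ L * ‖concat z - concat w‖)
    (lam b δ : ℝ) (hlam : 1 ≤ lam) (hb : 0 ≤ b) (hδ0 : 0 < δ) (hδ1 : δ < 1)
    (T : ℕ) (hT : 1 ≤ T)
    -- the probability space, the information available before and after the noise of each round
    {Ω : Type*} [mΩ : MeasurableSpace Ω] (μ : Measure Ω) [IsProbabilityMeasure μ]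
    (ℱ : Filtration ℕ mΩ)
    -- imperfect contexts, true contexts, selected arms, noise and observed rewards
    (xhat x : ℕ → Ω → X) (a : ℕ → Ω → A) (n y : ℕ → Ω → ℝ)
    (hx : ∀ t, 1 ≤ t → t ≤ T → Measurable[ℱ (t - 1)] (x t))
    (ha : ∀ t, 1 ≤ t → t ≤ T → Measurable[ℱ (t - 1)] (a t))
    (hn : ∀ t, 1 ≤ t → t ≤ T → Measurable[ℱ t] (n t))
    (hsub : ∀ t, 1 ≤ t → t ≤ T → ∀ σ : ℝ,
      Integrable (fun ω => Real.exp (σ * n t ω)) μ ∧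
      μ[fun ω => Real.exp (σ * n t ω) | ℱ (t - 1)] ≤ᵐ[μ] fun _ => Real.exp (σ ^ 2 * b ^ 2 / 2))
    (hy : ∀ t, 1 ≤ t → t ≤ T → ∀ ω, y t ω = f (x t ω, a t ω) + n t ω)
    (hball : ∀ t, 1 ≤ t → t ≤ T → ∀ ω, x t ω ∈ defenseRegion nrm Δ (xhat t ω))
    -- the arms are selected by MinWD
    (hMinWD : ∀ t, 1 ≤ t → t ≤ T → ∀ ω,
      IsMinWDArm (defenseRegion nrm Δ (xhat t ω))
        (ucb H lam B b δ (fun s => (x s ω, a s ω)) (fun s => y s ω) t) (a t ω))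
    -- the covering of the context-arm space
    (κ : ℝ) (hκ : 0 ≤ κ) (ε : ℝ) (hε : ε = coverRadius κ (p + q) T)
    (N : ℕ) (hN : N = numGroups κ ε (p + q))
    (C : Finset (X × A)) (hC : IsCovering ε C) :
    ∃ E : Set Ω, MeasurableSet E ∧ ENNReal.ofReal (1 - δ) ≤ μ E ∧
      ∀ ω ∈ E, Recurrent ε C N (fun s => (x s ω, a s ω)) →
        ∀ w : ℕ → X × A,
          (∀ t, 1 ≤ t → t ≤ T →
            IsConsideredPair (defenseRegion nrm Δ (xhat t ω)) f
              (ucb H lam B b δ (fun s => (x s ω, a s ω)) (fun s => y s ω) t) (w t)) →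
          (∃ ζ : ℕ → ℕ, IsMatching ε C N T (fun s => (x s ω, a s ω)) w ζ) ∧
          ∀ ζ : ℕ → ℕ, IsMatching ε C N T (fun s => (x s ω, a s ω)) w ζ →
            ∀ (h dbar dtil : ℝ),
              h = confRadius H lam B b δ (fun s => (x s ω, a s ω)) T →
              dbar = ((gram H (fun s => (x s ω, a s ω)) T).rank : ℝ) →
              dtil = (effDim H (fun s => (x s ω, a s ω)) ζ N (T / N) : ℝ) →
              ∑ t ∈ Finset.Icc 1 T, f (x t ω, a t ω) ≥
                ∑ t ∈ Finset.Icc 1 T,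
                  (optWorstReward (defenseRegion nrm Δ (xhat t ω)) f
                    - optWorstRegret (defenseRegion nrm Δ (xhat t ω)) f)
                - 2 * h * (T : ℝ) ^ (3 / 4 : ℝ)
                    * √(4 * dtil * Real.log (1 + T / (dtil * lam)) + 1 / lam)
                - 4 * √(2 / lam) * L * κ ^ (1 / ((p + q : ℕ) : ℝ)) * h
                    * (T : ℝ) ^ (1 - 1 / (2 * ((p + q : ℕ) : ℝ)))
                - 2 * h * √(2 * T * dbar * Real.log (1 + T / (dbar * lam))) := by

  have hlam0 : 0 < lam := by linarith
  obtain ⟨E, hE, hμE, hnoise⟩ := exists_event_noise_le (μ := μ) ℱ hlam0 hb hδ0 hδ1 (T - 1)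
    (fun i ω => feature H (x (i + 1) ω, a (i + 1) ω)) (fun i => n (i + 1))
    (fun k hk i hi j hj => by
      have hz : ∀ i ≤ k, Measurable[ℱ k] fun ω => (x (i + 1) ω, a (i + 1) ω) := fun i hi =>
        Measurable.prodMk ((hx (i + 1) (by omega) (by omega)).mono (ℱ.mono hi) le_rfl)
          ((ha (i + 1) (by omega) (by omega)).mono (ℱ.mono hi) le_rfl)
      exact measurable_inner_feature hLip (hz i hi) (hz j hj))
    (fun i hi => hn (i + 1) (by omega) (by omega))
    (fun i hi => hsub (i + 1) (by omega) (by omega))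
  refine ⟨E, hE, hμE, fun ω hω hrec w hw => ⟨exists_isMatching hC T hrec w, ?_⟩⟩
  rintro ζ hζ h dbar dtil rfl rfl rfl
  -- for `κ = 0` there are no rounds in which the cells could be visited
  have hκ0 : 0 < κ := by
    refine lt_of_le_of_ne hκ fun h0 => ?_
    obtain ⟨c, hc, -⟩ := hC (x 1 ω, a 1 ω)
    obtain ⟨t, h1, h2, -⟩ := hrec.1 c hc
    rw [hN, ← h0, numGroups_zero] at h2
    omega
  subst hε
  have hN' : N = ⌈√(T : ℝ)⌉₊ := by rw [hN, numGroups_coverRadius hκ0 hd]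
  refine sum_reward_ge hB hlam hb hk hL hLip (fun s => (x s ω, a s ω)) (fun s => y s ω)
    (fun t => defenseRegion nrm Δ (xhat t ω)) hT (fun t h1 h2 => ?_)
    (fun t h1 h2 => hball t h1 h2 ω) (fun t h1 h2 => hMinWD t h1 h2 ω) w hw hκ hN' hζ
  refine abs_estimate_sub_le H hlam0 hb hB _ _ (fun i => n (i + 1) ω) t
    (fun i hi => hy (i + 1) (by omega) (by omega) ω) ?_
  have := hnoise ω hω (t - 1) (by omega)
  rw [infoGain, gram_eq]
  exact this
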